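/- **Setting.** Let $n\ge 2$, $a_0,\dots,a_{n-1}\in\mathbb C$, $a_n=1$, and let $r_0,\dots,r_{n-1}:\mathbb R\to\mathbb C$, $r_n\equiv 0$. Write $P(c;x)=\sum_{i=0}^n c_ix^i$. Assume that $P(a;x)$ has $n$ roots $\lambda,\lambda_1,\dots,\lambda_{n-1}$ with pairwise different real parts; put $\gamma_j=\lambda_j-\lambda$, $\alpha_j=\Re\gamma_j$, $\Gamma_j=\prod_{k\ne j}(\gamma_j-\gamma_k)$, $\tilde\alpha_j=\sum_{i=0}^{n-2}|\gamma_j|^i$. Consider $$y^{(n)}+\sum_{i=0}^{n-1}(a_i+r_i(t))\,y^{(i)}=0,\qquad t\in\mathbb R.\tag{1}$$ *Spaces of functions $\mathbb R\to\mathbb C$.* $BC$: bounded continuous; $BC_0$: those $f\in BC$ with $f(t)\to0$ as $t\to+\infty$; $C_{00}$: those $f\in BC_0$ with $f(t)\to 0$ also as $t\to-\infty$. $\mathcal{AP}$: continuous $f$ such that every real sequence $(b_k)$ has a subsequence along which $f(\cdot+b_k)$ converges uniformly on $\mathbb R$. $\mathcal{AAP}$ (resp. $\mathcal{AAP}_0$):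 those $f\in BC$ of the form $f=\phi+g$ with $\phi\in\mathcal{AP}$ and $g(t)\to0$ as $t\to+\infty$ (resp. as $t\to\pm\infty$). For such a class $E$, $E^{k}$ is the set of $C^k$ functions $f$ with $f^{(i)}\in E$ for $0\le i\le k$. *Green operators.* For $\Re\omega\neq0$ let $g_\omega(t,s)=-\mathrm{sgn}(\Re\omega)e^{\omega(t-s)}$ if $\mathrm{sgn}(\Re\omega)(t-s)<0$, and $g_\omega(t,s)=0$ otherwise; $G_\omega[f](t)=\int_{\mathbb R}g_\omega(t,s)f(s)\,ds$, $I_\omega[f](t)=\int_{\mathbb R}|g_\omega(t,s)f(s)|\,ds$, and $G[f]=\sum_{j=1}^{n-1}\Gamma_j^{-1}G_{\gamma_j}[f]$. *Riccati type equation.* Let $B_i$ be the complete Bell polynomials, $B_0=1$, $B_{i+1}(x_1,\dots,x_{i+1})=\sum_{j=0}^i\binom ij B_{i-j}(x_1,\dots,x_{i-j})x_{j+1}$, and $f_i(x_1,\dots,x_i)=B_{i+1}(x_1,\dots,x_{i+1})-x_{i+1}$. Abbreviate $B_i(z)=B_i(z,z',\dots,z^{(i-1)})$, $f_i(z)=f_i(z,\dots,z^{(i-1)})$.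 Put $$\mathcal Dz=\sum_{j=1}^n\tfrac1{j!}\partial_x^jP(a;\lambda)z^{(j-1)},\quad \mathcal L_c(\cdot,z)=\sum_{k=1}^{n-1}\tfrac1{k!}\partial_x^kP(c;\lambda)z^{(k-1)},$$ $$\mathcal S_c[(E_i)]=\sum_{i=2}^n\sum_{j=0}^{n-i}\binom{i+j}{j}c_{i+j}\lambda^jE_i,\qquad \mathcal F_c(\cdot,z)=\mathcal S_{a+c}[(f_{i-1}(z))_i],$$ with $\lambda^0=1$, and consider $$\mathcal Dz+P(r;\lambda)+\mathcal L_r(\cdot,z)+\mathcal F_r(\cdot,z)=0\quad\text{on }\mathbb R.\tag{2}$$ *Smallness condition.* With $|x|_1=\sum_k|x_k|$ on $\mathbb C^i$, let $m_i(\delta)=\sup\{|f_i(X)-f_i(Y)|/|X-Y|_1: X\ne Y,\ |X|_1,|Y|_1<\delta\}$ and $m(\delta)=\max_{1\le i\le n-1}m_i(\delta)$. Let $$L_0=\sum_{j=1}^{n-1}\sum_{k=1}^{n-1}\frac{\tilde\alpha_j}{|\Gamma_j|k!}\big\|I_{\alpha_j}[\partial_x^kP(r;\lambda)]\big\|_\infty,\qquad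 H=\Big\|\sum_{i=0}^{n-2}\big|G[P(r;\lambda)]^{(i)}\big|\Big\|_\infty,$$ $$Q_0=\sum_{j=1}^{n-1}\sum_{i=2}^n\sum_{k=0}^{i-2}\frac{\tilde\alpha_j}{|\Gamma_j|}\binom ik|\lambda|^k\Big(\frac{|a_i|}{|\alpha_j|}+\big\|I_{\alpha_j}[|r_i|]\big\|_\infty\Big).$$ Condition (C): $L_0<1$, and $H\le\max\{[1-L_0-m(\delta)Q_0]\,\delta:\delta\in(0,\delta_\lambda)\}$, where $\delta_\lambda>0$ is such that $0<m(\delta)<(1-L_0)/Q_0$ for $\delta\in(0,\delta_\lambda)$ and $m(\delta_\lambda)=(1-L_0)/Q_0$. **Theorem.** Let $(A,V)=(\mathcal{AAP},BC_0)$ (resp. $(A,V)=(\mathcal{AAP}_0,C_{00})$). Let $r_i\in A$ for $i=0,\dots,n-1$ and assume (C). (i) There are a solution $y$ of (1) and a solution $z\in A^{n-2}$ of (2) such that, with $h=P(r;\lambda)+\mathcal L_r(\cdot,z)+\mathcal F_r(\cdot,z)$, $$y(t)=e^{\lambda t}\exp\Big((-1)^n\prod_{j=1}^{n-1}\gamma_j^{-1}\int_0^th(s)\,ds\Big)\exp\Big(-\sum_{j=1}^{n-1}\frac1{\Gamma_j\gamma_j}G_{\gamma_j}[h](t)\Big),\qquad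 t\in\mathbb R.$$ Moreover, whenever $r_i=\mu_i+\nu_i$ with $\mu_i\in\mathcal{AP}$ and $\nu_i\in V$ for $i=0,\dots,n-1$ (and $\mu_n=\nu_n=0$), this $z$ can be written $z=\theta+\psi$ with $\theta\in\mathcal{AP}^{n-2}$, $\psi\in V^{n-2}$ satisfying, with absolutely convergent integrals, $$\theta=-G\big[P(\mu;\lambda)+\mathcal L_\mu(\cdot,\theta)+\mathcal F_\mu(\cdot,\theta)\big],\tag{3}$$ $$\psi=-G\big[P(\nu;\lambda)+\mathcal L_\nu(\cdot,\theta)+\mathcal S_\nu[(f_{i-1}(\theta))_i]+\mathcal L_r(\cdot,\psi)+\tilde{\mathcal L}_\theta(\cdot,\psi)+\tilde{\mathcal F}_\theta(\cdot,\psi)\big],\tag{4}$$ where $$\tilde{\mathcal L}_\theta(\cdot,\psi)=\mathcal S_{a+r}\Big[\Big(\sum_{k=1}^{i-1}\binom ikB_{i-k}(\theta)\psi^{(k-1)}\Big)_i\Big],\qquad \tilde{\mathcal F}_\theta(\cdot,\psi)=\mathcal S_{a+r}\Big[\Big(\sum_{k=2}^{i}\binom ikB_{i-k}(\theta)\big[B_k(\psi)-\psi^{(k-1)}\big]\Big)_i\Big].$$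 (ii) Conversely, let $r_i=\mu_i+\nu_i$ be as in (i), and let $\theta\in\mathcal{AP}$ and $\psi\in V$ be of class $C^{n-2}$ and satisfy (3) and (4) with absolutely convergent integrals. Then $z=\theta+\psi\in A$ is a solution of (2), and $t\mapsto\exp\big(\int_0^t[\lambda+z(s)]\,ds\big)$ is a solution of (1). If moreover $\theta\in\mathcal{AP}^{n-2}$ and $\psi\in V^{n-2}$, then $z\in A^{n-2}$. -/

import Mathlib

open Filter Topology Set Polynomial

noncomputable section

namespace PoincarePerron

/-! ### Function spaces -/

/-- Bounded continuous functions `ℝ → ℂ`. -/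
def BC : Set (ℝ → ℂ) := {f | Continuous f ∧ ∃ K : ℝ, ∀ t, ‖f t‖ ≤ K}

/-- Bounded continuous functions vanishing at `+∞`. -/
def BC0 : Set (ℝ → ℂ) := {f | f ∈ BC ∧ Tendsto f atTop (𝓝 0)}

/-- Bounded continuous functions vanishing at `+∞` and at `-∞`. -/
def C00 : Set (ℝ → ℂ) := {f | f ∈ BC0 ∧ Tendsto f atBot (𝓝 0)}

/-- Almost periodic functions (Bochner's definition): every sequence of translations has a
uniformly convergent subsequence. -/
def AP : Set (ℝ → ℂ) :=
  {f | Continuous f ∧ ∀ b : ℕ → ℝ, ∃ φ : ℕ → ℕ, StrictMono φ ∧ ∃ g : ℝ → ℂ,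
    TendstoUniformly (fun (m : ℕ) (t : ℝ) => f (t + b (φ m))) g atTop}

/-- Asymptotically almost periodic functions. -/
def AAP : Set (ℝ → ℂ) :=
  {f | f ∈ BC ∧ ∃ φ g : ℝ → ℂ, φ ∈ AP ∧ Tendsto g atTop (𝓝 0) ∧ ∀ t, f t = φ t + g t}

/-- The class `AAP₀`: the vanishing summand tends to zero at both ends. -/
def AAP0 : Set (ℝ → ℂ) :=
  {f | f ∈ BC ∧ ∃ φ g : ℝ → ℂ, φ ∈ AP ∧ Tendsto g atTop (𝓝 0) ∧ Tendsto g atBot (𝓝 0) ∧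
    ∀ t, f t = φ t + g t}

/-- For a class `E` of functions, `DerivsIn E k` is the class of `C^k` functions all of whose
derivatives of order `0, …, k` lie in `E`. -/
def DerivsIn (E : Set (ℝ → ℂ)) (k : ℕ) : Set (ℝ → ℂ) :=
  {f | ContDiff ℝ k f ∧ ∀ i ≤ k, iteratedDeriv i f ∈ E}

/-- The supremum norm on `ℝ` (used for bounded functions only). -/
def supNorm (f : ℝ → ℝ) : ℝ := ⨆ t : ℝ, |f t|

/-! ### Green's kernels and operators -/

/-- The scalar kernel `g_ω(t,s)`. -/
def green (ω : ℂ) (t s : ℝ) : ℂ :=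
  if Real.sign ω.re * (t - s) < 0 then
    -(Real.sign ω.re : ℂ) * Complex.exp (ω * ((t : ℂ) - (s : ℂ)))
  else 0

/-- `G_ω[f](t) = ∫ g_ω(t,s) f(s) ds`. -/
def GOp (ω : ℂ) (f : ℝ → ℂ) (t : ℝ) : ℂ := ∫ s : ℝ, green ω t s * f s

/-- `I_ω[f](t) = ∫ |g_ω(t,s) f(s)| ds`. -/
def IOp (ω : ℂ) (f : ℝ → ℂ) (t : ℝ) : ℝ := ∫ s : ℝ, ‖green ω t s * f s‖

/-- `Γ_j = ∏_{k ≠ j} (γ_j - γ_k)`. -/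
def bigGamma {N : ℕ} (γ : Fin N → ℂ) (j : Fin N) : ℂ :=
  ∏ k ∈ Finset.univ.erase j, (γ j - γ k)

/-- Green's operator `G[f] = ∑_j Γ_j⁻¹ G_{γ_j}[f]`. -/
def Green {N : ℕ} (γ : Fin N → ℂ) (f : ℝ → ℂ) (t : ℝ) : ℂ :=
  ∑ j, (1 / bigGamma γ j) * GOp (γ j) f t

/-- The integral equation `z = -G[h]`, including the absolute convergence of the integrals that
define `G[h]`. -/
def SolvesGreen {N : ℕ} (γ : Fin N → ℂ) (z h : ℝ → ℂ) : Prop :=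
  ∀ t : ℝ, (∀ j, MeasureTheory.Integrable (fun s : ℝ => green (γ j) t s * h s)) ∧
    z t = -Green γ h t

/-! ### Complete Bell polynomials -/

/-- Complete Bell polynomials; `x k` stands for the variable `x_{k+1}`, and only the first `i`
variables enter in `bell i`. -/
def bell : ℕ → (ℕ → ℂ) → ℂ
  | 0, _ => 1
  | i + 1, x => ∑ j : Fin (i + 1), (i.choose j : ℂ) * bell (i - j) x * x j
  decreasing_by omega

/-- The nonlinear part `f_i(x_1,…,x_i) = B_{i+1}(x_1,…,x_{i+1}) - x_{i+1}`, written without the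
variable `x_{i+1}` that cancels. -/
def bellF (i : ℕ) (x : ℕ → ℂ) : ℂ :=
  ∑ j ∈ Finset.range i, (i.choose j : ℂ) * bell (i - j) x * x j

theorem bell_zero (x : ℕ → ℂ) : bell 0 x = 1 := by
  rw [bell]

theorem bell_succ (i : ℕ) (x : ℕ → ℂ) :
    bell (i + 1) x = ∑ j ∈ Finset.range (i + 1), (i.choose j : ℂ) * bell (i - j) x * x j := by
  rw [bell, Finset.sum_range]

theorem bellF_eq (i : ℕ) (x : ℕ → ℂ) : bellF i x = bell (i + 1) x - x i := by
  rw [bell_succ, Finset.sum_range_succ, bellF]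
  simp [bell_zero]

/-- The vector `(z(t), z'(t), z''(t), …)`. -/
def jet (z : ℝ → ℂ) (t : ℝ) : ℕ → ℂ := fun k => iteratedDeriv k z t

/-! ### The linear equation and the Riccati type equation -/

/-- `P(c;x) = c_0 + c_1 x + ⋯ + c_n x^n`. -/
def P (n : ℕ) (c : ℕ → ℂ) : ℂ[X] := ∑ i ∈ Finset.range (n + 1), C (c i) * X ^ i

/-- `(1/k!) ∂^k P(c;x)/∂x^k` at `x = lam`. -/
def dP (n : ℕ) (c : ℕ → ℂ) (k : ℕ) (lam : ℂ) : ℂ :=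
  (1 / (k.factorial : ℂ)) * (derivative^[k] (P n c)).eval lam

/-- `y` solves `y^(n) + ∑_{i<n} (a_i + r_i(t)) y^(i) = 0` on `ℝ`. -/
def SolvesLinear (n : ℕ) (a : ℕ → ℂ) (r : ℕ → ℝ → ℂ) (y : ℝ → ℂ) : Prop :=
  ContDiff ℝ n y ∧ ∀ t : ℝ,
    iteratedDeriv n y t + ∑ i ∈ Finset.range n, (a i + r i t) * iteratedDeriv i y t = 0

/-- The constant coefficient operator `D z = ∑_{j=1}^n (1/j!) ∂^j P(a;lam) z^(j-1)`. -/
def opD (n : ℕ) (a : ℕ → ℂ) (lam : ℂ) (z : ℝ → ℂ) (t : ℝ) : ℂ :=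
  ∑ j ∈ Finset.Icc 1 n, dP n a j lam * iteratedDeriv (j - 1) z t

/-- The linear part with variable coefficients,
`L(t,z) = ∑_{k=1}^{n-1} (1/k!) ∂^k P(r(t);lam) z^(k-1)(t)`. -/
def opL (n : ℕ) (r : ℕ → ℝ → ℂ) (lam : ℂ) (z : ℝ → ℂ) (t : ℝ) : ℂ :=
  ∑ k ∈ Finset.Icc 1 (n - 1), dP n (fun i => r i t) k lam * iteratedDeriv (k - 1) z t

/-- `∑_{i=2}^n ∑_{j=0}^{n-i} binom(i+j,j) c_{i+j} lam^j E_i`: the common shape of all the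
nonlinear terms. -/
def weighted (n : ℕ) (c : ℕ → ℂ) (lam : ℂ) (E : ℕ → ℂ) : ℂ :=
  ∑ i ∈ Finset.Icc 2 n, ∑ j ∈ Finset.range (n - i + 1),
    ((i + j).choose j : ℂ) * c (i + j) * lam ^ j * E i

/-- The nonlinear term `F(t,Z)`. -/
def opF (n : ℕ) (a : ℕ → ℂ) (r : ℕ → ℝ → ℂ) (lam : ℂ) (z : ℝ → ℂ) (t : ℝ) : ℂ :=
  weighted n (fun i => a i + r i t) lam (fun i => bellF (i - 1) (jet z t))

/-- `P(r;lam)(t) + L(t,z) + F(t,Z)`. -/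
def riccatiRHS (n : ℕ) (a : ℕ → ℂ) (r : ℕ → ℝ → ℂ) (lam : ℂ) (z : ℝ → ℂ) (t : ℝ) : ℂ :=
  (P n (fun i => r i t)).eval lam + opL n r lam z t + opF n a r lam z t

/-- `z` solves the Riccati type equation `D z + P(r;lam) + L(t,z) + F(t,Z) = 0` on `ℝ`. -/
def SolvesRiccati (n : ℕ) (a : ℕ → ℂ) (r : ℕ → ℝ → ℂ) (lam : ℂ) (z : ℝ → ℂ) : Prop :=
  ContDiff ℝ (n - 1 : ℕ) z ∧ ∀ t : ℝ, opD n a lam z t + riccatiRHS n a r lam z t = 0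

/-- The function
`e^{lam t} exp((-1)^n ∏ γ_j⁻¹ ∫_0^t h) exp(-∑_j (Γ_j γ_j)⁻¹ G_{γ_j}[h](t))`. -/
def explicitY (n : ℕ) {N : ℕ} (γ : Fin N → ℂ) (lam : ℂ) (h : ℝ → ℂ) (t : ℝ) : ℂ :=
  Complex.exp (lam * t) *
    Complex.exp ((-1) ^ n * (∏ j, (γ j)⁻¹) * ∫ s in (0 : ℝ)..t, h s) *
    Complex.exp (-∑ j, (1 / (bigGamma γ j * γ j)) * GOp (γ j) h t)

/-! ### The terms of the equation for the vanishing part -/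

/-- `∑_{i,j} binom(i+j,j) ν_{i+j}(t) lam^j f_{i-1}(θ, θ', …)`. -/
def opFnu (n : ℕ) (ν : ℕ → ℝ → ℂ) (lam : ℂ) (θ : ℝ → ℂ) (t : ℝ) : ℂ :=
  weighted n (fun i => ν i t) lam (fun i => bellF (i - 1) (jet θ t))

/-- The part of `F(t,Θ+Ψ)` that is linear in `ψ`. -/
def opLtheta (n : ℕ) (a : ℕ → ℂ) (r : ℕ → ℝ → ℂ) (lam : ℂ) (θ ψ : ℝ → ℂ) (t : ℝ) : ℂ :=
  weighted n (fun i => a i + r i t) lam (fun i =>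
    ∑ k ∈ Finset.Icc 1 (i - 1), (i.choose k : ℂ) * bell (i - k) (jet θ t) * jet ψ t (k - 1))

/-- The part of `F(t,Θ+Ψ)` that is of higher order in `ψ`; the bracket
`B_k(ψ,…,ψ^(k-1)) - ψ^(k-1)` is `bellF (k - 1)`. -/
def opFtheta (n : ℕ) (a : ℕ → ℂ) (r : ℕ → ℝ → ℂ) (lam : ℂ) (θ ψ : ℝ → ℂ) (t : ℝ) : ℂ :=
  weighted n (fun i => a i + r i t) lam (fun i =>
    ∑ k ∈ Finset.Icc 2 i, (i.choose k : ℂ) * bell (i - k) (jet θ t) * bellF (k - 1) (jet ψ t))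

/-- `P(ν;lam) + L_ν(·,θ) + F_ν(·,Θ) + L(·,ψ) + L_θ(·,Ψ) + F_θ(·,Ψ)`. -/
def psiRHS (n : ℕ) (a : ℕ → ℂ) (r ν : ℕ → ℝ → ℂ) (lam : ℂ) (θ ψ : ℝ → ℂ) (t : ℝ) : ℂ :=
  (P n (fun i => ν i t)).eval lam + opL n ν lam θ t + opFnu n ν lam θ t
    + opL n r lam ψ t + opLtheta n a r lam θ ψ t + opFtheta n a r lam θ ψ t

/-! ### The smallness condition -/

/-- The norm `∑_{k<i} |x_k|` on `ℂ^i`. -/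
def ell1 (i : ℕ) (x : ℕ → ℂ) : ℝ := ∑ k ∈ Finset.range i, ‖x k‖

/-- The optimal Lipschitz constant of `f_i` on the ball of radius `δ` of `ℂ^i` (points of `ℂ^i`
are the first `i` entries of sequences). -/
def mLip (i : ℕ) (δ : ℝ) : ℝ :=
  sSup {q : ℝ | ∃ x y : ℕ → ℂ, (∃ k < i, x k ≠ y k) ∧ ell1 i x < δ ∧ ell1 i y < δ ∧
    q = ‖bellF i x - bellF i y‖ / ell1 i (x - y)}

/-- `m(δ) = max_{1 ≤ i ≤ n-1} m_i(δ)`. -/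
def m (n : ℕ) (δ : ℝ) : ℝ := ⨆ i : Fin (n - 1), mLip (i + 1) δ

/-- `∑_{i=0}^{n-2} |γ|^i`. -/
def alphaTilde (n : ℕ) (γ : ℂ) : ℝ := ∑ i ∈ Finset.range (n - 1), ‖γ‖ ^ i

/-- The constant `L₀`. -/
def L0 (n : ℕ) (r : ℕ → ℝ → ℂ) (lam : ℂ) {N : ℕ} (γ : Fin N → ℂ) : ℝ :=
  ∑ j, ∑ k ∈ Finset.Icc 1 (n - 1), alphaTilde n (γ j) / (‖bigGamma γ j‖ * k.factorial) *
    supNorm (IOp ((γ j).re : ℂ) (fun s => (derivative^[k] (P n (fun i => r i s))).eval lam))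

/-- The constant `Q₀`. -/
def Q0 (n : ℕ) (a : ℕ → ℂ) (r : ℕ → ℝ → ℂ) (lam : ℂ) {N : ℕ} (γ : Fin N → ℂ) : ℝ :=
  ∑ j, ∑ i ∈ Finset.Icc 2 n, ∑ k ∈ Finset.range (i - 1),
    alphaTilde n (γ j) / ‖bigGamma γ j‖ * (i.choose k : ℝ) * ‖lam‖ ^ k *
      (‖a i‖ / |(γ j).re| + supNorm (IOp ((γ j).re : ℂ) (fun s => (‖r i s‖ : ℂ))))

/-- The constant `H = ‖ ∑_{i=0}^{n-2} |G[P(r;lam)]^(i)| ‖_∞`. -/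
def H (n : ℕ) (r : ℕ → ℝ → ℂ) (lam : ℂ) {N : ℕ} (γ : Fin N → ℂ) : ℝ :=
  supNorm (fun t => ∑ i ∈ Finset.range (n - 1),
    ‖iteratedDeriv i (Green γ (fun s => (P n (fun l => r l s)).eval lam)) t‖)

/-- The smallness condition: `L₀ < 1` and
`H ≤ max {(1 - L₀ - m(δ) Q₀) δ | δ ∈ (0, δ₀)}`, where `δ₀ > 0` is the point with
`m(δ₀) = (1 - L₀)/Q₀` and `0 < m < (1 - L₀)/Q₀` on `(0, δ₀)`. -/
def Smallness (n : ℕ) (a : ℕ → ℂ) (r : ℕ → ℝ → ℂ) (lam : ℂ) {N : ℕ} (γ : Fin N → ℂ) : Prop :=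
  L0 n r lam γ < 1 ∧
  ∃ δ₀ : ℝ, 0 < δ₀ ∧
    (∀ δ ∈ Ioo 0 δ₀, 0 < m n δ ∧ m n δ < (1 - L0 n r lam γ) / Q0 n a r lam γ) ∧
    m n δ₀ = (1 - L0 n r lam γ) / Q0 n a r lam γ ∧
    ∃ K : ℝ,
      IsGreatest ((fun δ => (1 - L0 n r lam γ - m n δ * Q0 n a r lam γ) * δ) '' Ioo 0 δ₀) K ∧
      H n r lam γ ≤ K

/-- `r_i = μ_i + ν_i` with `μ_i` almost periodic and `ν_i ∈ V` for `i < n`, together with the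
convention `μ_n = ν_n = 0`. -/
def Decomposes (n : ℕ) (V : Set (ℝ → ℂ)) (r μ ν : ℕ → ℝ → ℂ) : Prop :=
  (∀ i < n, μ i ∈ AP ∧ ν i ∈ V ∧ ∀ t, r i t = μ i t + ν i t) ∧
    (∀ t, μ n t = 0) ∧ (∀ t, ν n t = 0)

end PoincarePerron

end

open PoincarePerron

noncomputable section

namespace PoincarePerron

/-! ### Complete Bell polynomials -/

/-! Write `y = e^{λt} w` with `w' = z w`. Leibniz' rule for `z w` is the recursion of the Bell
polynomials, so `w^(k) = B_k(z) w`, and the linear equation becomes `∑_k (1/k!) ∂^k P(a+r;λ) B_k(z)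
= 0`. Since `P(a;λ) = 0`, `r_n = 0` and `B_k(z) = z^(k-1) + f_{k-1}(z)` for `k ≥ 1`, this is the
Riccati type equation `D z + h(z) = 0`, in which `h(z)` involves derivatives of `z` up to order `n -
2` only (`solvesLinear_of_solvesRiccati`).

The characteristic roots of `D` are the `γ_j`, all off the imaginary axis. Each `G_{γ_j}[h]` solves
`u' = γ_j u + h`, and Lagrange interpolation identities for the weights `1/Γ_j` show that `z =
-G[h]` satisfies `D z = -h` (`solvesRiccati_of_green`). One more Lagrange sum integrates `-G[h]`
explicitly and yields the formula for `y` (`hasDerivAt_explicitY`).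

It remains to solve `z = -G[h(z)]`. The unknown is a bounded curve of jets `(z, …, z^(n-2))`. On the
closed ball whose radius `δ` is the maximiser in the smallness condition, the integral operator has
Lipschitz constant `L₀ + m(δ) Q₀ < 1` and moves the origin by at most `H`, so the ball is preserved.
Curves with components in `A` form a closed invariant subset: `G_ω` preserves almost periodicity and
vanishing at the ends, and `A` is closed under uniform limits because an almost periodic `φ` comes
back near each of its values arbitrarily far to the right, whence `‖φ‖ ≤ ‖φ + g‖` if `g` vanishes at
`+∞`. Banach's theorem gives the fixed point inside `A` (`exists_fixed_jetCurve`).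

The equations for `θ` and `ψ` need no second fixed point. Split `h(z) = h₁ + h₂` into an almost
periodic and a vanishing part, and put `θ = -G[h₁]`, `ψ = -G[h₂]`. The binomial identity `bell_add`
expands `h(z)` around `θ` into the two required right hand sides (`riccatiRHS_split`); one is almost
periodic, the other vanishes, so by uniqueness of the decomposition they are `h₁` and `h₂`.
Conversely, adding the two equations gives back `z = -G[h(z)]` (`solves_of_solvesGreen`). -/

theorem bell_congr {x y : ℕ → ℂ} (i : ℕ) (h : ∀ k < i, x k = y k) : bell i x = bell i y := by
  induction i using Nat.strong_induction_on with
  | _ i ih =>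
    cases i with
    | zero => simp [bell_zero]
    | succ i =>
      rw [bell_succ, bell_succ]
      refine Finset.sum_congr rfl fun j hj => ?_
      have hj' := Finset.mem_range.1 hj
      rw [ih (i - j) (by omega) (fun k hk => h k (by omega)), h j hj']

theorem bellF_congr {x y : ℕ → ℂ} (i : ℕ) (h : ∀ k < i, x k = y k) : bellF i x = bellF i y := by
  refine Finset.sum_congr rfl fun j hj => ?_
  have hj' := Finset.mem_range.1 hj
  rw [bell_congr (i - j) (fun k hk => h k (by omega)), h j hj']

/-- The exponential generating function of a sequence. -/
def egf (x : ℕ → ℂ) : PowerSeries ℂ := PowerSeries.mk fun i => x i / (i.factorial : ℂ)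

theorem coeff_egf_mul (x y : ℕ → ℂ) (n : ℕ) :
    (n.factorial : ℂ) * PowerSeries.coeff n (egf x * egf y) =
      ∑ j ∈ Finset.range (n + 1), (n.choose j : ℂ) * x (n - j) * y j := by
  rw [PowerSeries.coeff_mul, Finset.Nat.sum_antidiagonal_eq_sum_range_succ_mk,
    ← Finset.sum_range_reflect, Finset.mul_sum]
  refine Finset.sum_congr rfl fun j hj => ?_
  have hj' : j ≤ n := Nat.lt_succ_iff.1 (Finset.mem_range.1 hj)
  have h1 : n + 1 - 1 - j = n - j := by omega
  have h2 : n - (n - j) = j := by omega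
  simp only [h1, h2, egf, PowerSeries.coeff_mk]
  have h3 : ((n.choose j : ℕ) : ℂ) * j.factorial * (n - j).factorial = n.factorial := by
    exact_mod_cast Nat.choose_mul_factorial_mul_factorial hj'
  have := Nat.factorial_ne_zero j
  have := Nat.factorial_ne_zero (n - j)
  rw [← h3]
  field_simp

/-- The Bell recursion is a binomial convolution, hence a product of exponential generating
functions: that of the Bell polynomials is the formal exponential of the primitive of `egf x`. -/
theorem derivative_egf_bell (x : ℕ → ℂ) :
    PowerSeries.derivative ℂ (egf fun i => bell i x) = egf (fun i => bell i x) * egf x := by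
  ext n
  have hn : (n.factorial : ℂ) ≠ 0 := by exact_mod_cast Nat.factorial_ne_zero n
  apply mul_left_cancel₀ hn
  rw [coeff_egf_mul, ← bell_succ, PowerSeries.coeff_derivative]
  simp only [egf, PowerSeries.coeff_mk, Nat.factorial_succ]
  push_cast
  have : (n : ℂ) + 1 ≠ 0 := by exact_mod_cast Nat.succ_ne_zero n
  field_simp

/-- A first order linear formal differential equation determines each coefficient from the earlier
ones. -/
theorem eq_egf_bell {F : PowerSeries ℂ} {x : ℕ → ℂ} (h0 : PowerSeries.coeff 0 F = 1)
    (h : PowerSeries.derivative ℂ F = F * egf x) : F = egf fun i => bell i x := by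
  ext n
  induction n using Nat.strong_induction_on with
  | _ n ih =>
    cases n with
    | zero => rw [h0]; simp [egf, bell_zero]
    | succ n =>
      have : (n : ℂ) + 1 ≠ 0 := by exact_mod_cast Nat.succ_ne_zero n
      apply mul_right_cancel₀ this
      rw [← PowerSeries.coeff_derivative, ← PowerSeries.coeff_derivative, h,
        derivative_egf_bell, PowerSeries.coeff_mul, PowerSeries.coeff_mul]
      refine Finset.sum_congr rfl fun p hp => ?_
      rw [ih p.1 (by have := Finset.HasAntidiagonal.mem_antidiagonal.1 hp; omega)]

/-- Complete Bell polynomials are of binomial type. -/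
theorem bell_add (i : ℕ) (x y : ℕ → ℂ) :
    bell i (x + y) =
      ∑ k ∈ Finset.range (i + 1), (i.choose k : ℂ) * bell (i - k) x * bell k y := by
  have hxy : egf (x + y) = egf x + egf y := by
    ext n; simp [egf, add_div]
  -- By Leibniz' rule the product solves the differential equation that characterises the series for
  -- `x + y`.
  have key : egf (fun i => bell i x) * egf (fun i => bell i y) = egf fun i => bell i (x + y) := by
    apply eq_egf_bell
    · simp [PowerSeries.coeff_mul, egf, bell_zero]
    · rw [Derivation.leibniz, derivative_egf_bell, derivative_egf_bell, hxy]
      simp only [smul_eq_mul]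
      ring
  have hi : (i.factorial : ℂ) ≠ 0 := by exact_mod_cast Nat.factorial_ne_zero i
  rw [← coeff_egf_mul (fun i => bell i x), key, egf, PowerSeries.coeff_mk]
  field_simp

theorem bellF_zero (x : ℕ → ℂ) : bellF 0 x = 0 := by simp [bellF]

theorem bellF_apply_zero (i : ℕ) : bellF i 0 = 0 := by simp [bellF]

theorem bell_eq_add_bellF {k : ℕ} (hk : 1 ≤ k) (x : ℕ → ℂ) :
    bell k x = x (k - 1) + bellF (k - 1) x := by
  rw [bellF_eq, Nat.sub_add_cancel hk]; ring

/-- Expansion of the nonlinear part around a point. -/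
theorem bellF_add {i : ℕ} (hi : 2 ≤ i) (x y : ℕ → ℂ) :
    bellF (i - 1) (x + y) = bellF (i - 1) x
      + ∑ k ∈ Finset.Icc 1 (i - 1), (i.choose k : ℂ) * bell (i - k) x * y (k - 1)
      + ∑ k ∈ Finset.Icc 2 i, (i.choose k : ℂ) * bell (i - k) x * bellF (k - 1) y := by
  obtain ⟨i, rfl⟩ : ∃ l, i = l + 2 := ⟨i - 2, by omega⟩
  have e1 : Finset.Icc 1 (i + 2 - 1) = Finset.Ico 1 (i + 2) := by
    ext; simp; omega
  have e2 : Finset.Icc 2 (i + 2) = Finset.Ico 2 (i + 3) := by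
    ext; simp; omega
  rw [bellF_eq, bellF_eq, Nat.sub_add_cancel (by omega), bell_add, e1, e2,
    Finset.sum_Ico_eq_sum_range, Finset.sum_Ico_eq_sum_range, Finset.sum_range_succ' _ (i + 2),
    show i + 2 - 1 = i + 1 by omega, show i + 3 - 2 = i + 1 by omega]
  have hb : ∀ k, bell (k + 1) y = y k + bellF k y := fun k => by rw [bellF_eq]; ring
  simp only [hb, mul_add, Finset.sum_add_distrib]
  -- Two boundary terms are split off: the top linear one, which has `B_0 = 1` and cancels against
  -- the variable subtracted in the nonlinear part, and the lowest nonlinear one, which is zero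
  -- because `f_0 = 0`. This explains the different ranges of the two sums.
  rw [Finset.sum_range_succ _ (i + 1), Finset.sum_range_succ' _ (i + 1)]
  have h3 : ∀ k, 1 + k - 1 = k := by omega
  have h4 : ∀ k, 2 + k - 1 = k + 1 := by omega
  have h5 : ∀ k, k + 1 + 1 = 2 + k := by omega
  simp only [h3, h4, h5, bellF_zero, bell_zero, Nat.choose_zero_right, Nat.sub_zero,
    Pi.add_apply]
  have h6 : i + 2 - (1 + (i + 1)) = 0 := by omega
  have h7 : (i + 2).choose (1 + (i + 1)) = 1 := by
    rw [show 1 + (i + 1) = i + 2 by omega, Nat.choose_self]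
  have h8 : ∀ k, k + 1 + 1 = 2 + k := by omega
  have h9 : ∀ k, 1 + (k + 1) = 2 + k := by omega
  simp only [h8, h9] at h6 h7 ⊢
  rw [show 2 + i - (2 + i) = 0 by omega, Nat.choose_self, bell_zero]
  push_cast
  ring_nf

/-! ### The coefficients of the Taylor expansion of `P` -/

theorem P_eval (n : ℕ) (c : ℕ → ℂ) (x : ℂ) :
    (P n c).eval x = ∑ i ∈ Finset.range (n + 1), c i * x ^ i := by
  simp [P, eval_finsetSum]

/-- The factor `1/k!` turns the `k`-th derivative into the Hasse derivative, which acts on monomials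
by binomial coefficients. -/
theorem dP_eq (n : ℕ) (c : ℕ → ℂ) (k : ℕ) (lam : ℂ) :
    dP n c k lam = ∑ i ∈ Finset.range (n + 1), (i.choose k : ℂ) * c i * lam ^ (i - k) := by
  have hk : (k.factorial : ℂ) ≠ 0 := by exact_mod_cast Nat.factorial_ne_zero k
  rw [dP, ← factorial_smul_hasseDeriv,
    show (k.factorial • hasseDeriv k) (P n c) = k.factorial • hasseDeriv k (P n c) from rfl, nsmul_eq_mul, eval_mul, eval_natCast,
    ← mul_assoc, one_div, inv_mul_cancel₀ hk, one_mul, P, map_sum, eval_finsetSum]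
  refine Finset.sum_congr rfl fun i _ => ?_
  rw [C_mul_X_pow_eq_monomial, hasseDeriv_monomial, eval_monomial]

theorem dP_zero (n : ℕ) (c : ℕ → ℂ) (lam : ℂ) : dP n c 0 lam = (P n c).eval lam := by
  simp [dP]

theorem dP_add (n : ℕ) (c d : ℕ → ℂ) (k : ℕ) (lam : ℂ) :
    dP n (fun i => c i + d i) k lam = dP n c k lam + dP n d k lam := by
  simp only [dP_eq, ← Finset.sum_add_distrib]
  exact Finset.sum_congr rfl fun i _ => by ring

theorem dP_congr {n : ℕ} {c d : ℕ → ℂ} (h : ∀ i ≤ n, c i = d i) (k : ℕ) (lam : ℂ) :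
    dP n c k lam = dP n d k lam := by
  simp only [dP_eq]
  exact Finset.sum_congr rfl fun i hi => by
    rw [h i (Nat.lt_succ_iff.1 (Finset.mem_range.1 hi))]

theorem dP_top (n : ℕ) (c : ℕ → ℂ) (lam : ℂ) : dP n c n lam = c n := by
  rw [dP_eq, Finset.sum_range_succ, Finset.sum_eq_zero]
  · simp
  · intro i hi
    rw [Nat.choose_eq_zero_of_lt (Finset.mem_range.1 hi)]; simp

/-- With `l = i + j` the inner sum is the `i`-th Taylor coefficient of `P(c;·)` at `lam`, so linear
and nonlinear terms carry weights of the same kind. -/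
theorem weighted_eq (n : ℕ) (c : ℕ → ℂ) (lam : ℂ) (E : ℕ → ℂ) :
    weighted n c lam E = ∑ i ∈ Finset.Icc 2 n, dP n c i lam * E i := by
  refine Finset.sum_congr rfl fun i hi => ?_
  have hi' := Finset.mem_Icc.1 hi
  rw [dP_eq, Finset.sum_mul, ← Finset.sum_range_add_sum_Ico _ (show i ≤ n + 1 by omega),
    Finset.sum_eq_zero (s := Finset.range i), zero_add, Finset.sum_Ico_eq_sum_range,
    show n + 1 - i = n - i + 1 by omega]
  · refine Finset.sum_congr rfl fun j _ => ?_
    rw [Nat.add_sub_cancel_left, Nat.choose_symm_add]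
  · intro j hj
    rw [Nat.choose_eq_zero_of_lt (Finset.mem_range.1 hj)]; simp

theorem taylor_P (n : ℕ) (c : ℕ → ℂ) (lam x : ℂ) :
    (P n c).eval (lam + x) = ∑ k ∈ Finset.range (n + 1), dP n c k lam * x ^ k := by
  simp only [P_eval, dP_eq, Finset.sum_mul]
  rw [Finset.sum_comm]
  refine Finset.sum_congr rfl fun i hi => ?_
  have hi' := Nat.lt_succ_iff.1 (Finset.mem_range.1 hi)
  rw [add_comm lam x, add_pow, Finset.mul_sum]
  refine Finset.sum_subset_zero_on_sdiff ?_ ?_ ?_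
  · intro k hk; simp only [Finset.mem_range] at *; omega
  · intro k hk
    simp only [Finset.mem_sdiff, Finset.mem_range] at hk
    rw [Nat.choose_eq_zero_of_lt (by omega)]; simp
  · intro k _; ring

/-! ### Lagrange sums -/

theorem bigGamma_ne_zero {N : ℕ} {γ : Fin N → ℂ} (hγ : Function.Injective γ) (j : Fin N) :
    bigGamma γ j ≠ 0 := by
  refine Finset.prod_ne_zero_iff.2 fun k hk => sub_ne_zero.2 fun h => ?_
  exact (Finset.mem_erase.1 hk).1 (hγ h).symm

/-- The left side is the coefficient of `X^(N-1)` in the Lagrange interpolant of `X^k`, and this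
interpolant is `X^k` itself. -/
theorem sum_pow_div_bigGamma {N : ℕ} {γ : Fin N → ℂ} (hγ : Function.Injective γ) {k : ℕ}
    (hk : k < N) :
    ∑ j, 1 / bigGamma γ j * γ j ^ k = if k = N - 1 then 1 else 0 := by
  have h := Lagrange.coeff_eq_sum (s := Finset.univ) (v := γ) hγ.injOn (P := X ^ k)
    (by simp [hk])
  rw [Finset.card_univ, Fintype.card_fin, coeff_X_pow] at h
  simp only [eval_pow, eval_X] at h
  simp only [eq_comm (a := k), h, bigGamma]
  exact Finset.sum_congr rfl fun j _ => by ring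

/-- Evaluate at `0` the Lagrange interpolant of the constant `1` at the nodes `γ_j`. -/
theorem sum_inv_bigGamma_mul {N : ℕ} (hN : 0 < N) {γ : Fin N → ℂ} (hγ : Function.Injective γ)
    (h0 : ∀ j, γ j ≠ 0) :
    ∑ j, 1 / (bigGamma γ j * γ j) = (-1) ^ (N + 1) * ∏ j, (γ j)⁻¹ := by
  have : NeZero N := ⟨hN.ne'⟩
  have h := Lagrange.eval_interpolate_not_at_node (s := Finset.univ) (v := γ) (x := 0) 1
    (fun i _ => (h0 i).symm)
  rw [Lagrange.interpolate_one hγ.injOn Finset.univ_nonempty, Lagrange.eval_nodal] at h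
  simp only [eval_one, zero_sub, Lagrange.nodalWeight, Pi.one_apply, mul_one,
    Finset.prod_inv_distrib, Finset.prod_neg, Finset.card_univ, Fintype.card_fin] at h
  have h1 : ∑ j, (∏ k ∈ Finset.univ.erase j, (γ j - γ k))⁻¹ * (-γ j)⁻¹ =
      -∑ j, 1 / (bigGamma γ j * γ j) := by
    rw [← Finset.sum_neg_distrib]
    refine Finset.sum_congr rfl fun j _ => ?_
    rw [bigGamma, inv_neg, one_div, mul_inv]; ring
  rw [h1] at h
  have h2 : ∏ j, γ j ≠ 0 := Finset.prod_ne_zero_iff.2 fun j _ => h0 j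
  have h3 : ((-1 : ℂ) ^ N) * (-1) ^ N = 1 := by rw [← mul_pow]; simp
  rw [Finset.prod_inv_distrib, pow_succ]
  field_simp
  linear_combination ((-1 : ℂ) ^ N) * h - (∏ j, γ j) * (∑ j, 1 / (bigGamma γ j * γ j)) * h3

/-! ### The right hand side as a function of the jet -/

/-- `P(r(t);lam) + L(t,x) + F(t,x)` at a jet `x`. -/
def rhsAt (n : ℕ) (a : ℕ → ℂ) (r : ℕ → ℝ → ℂ) (lam : ℂ) (x : ℕ → ℂ) (t : ℝ) : ℂ :=
  (P n (fun i => r i t)).eval lam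
    + ∑ k ∈ Finset.Icc 1 (n - 1), dP n (fun i => r i t) k lam * x (k - 1)
    + weighted n (fun i => a i + r i t) lam (fun i => bellF (i - 1) x)

theorem riccatiRHS_eq_rhsAt (n : ℕ) (a : ℕ → ℂ) (r : ℕ → ℝ → ℂ) (lam : ℂ) (z : ℝ → ℂ) (t : ℝ) :
    riccatiRHS n a r lam z t = rhsAt n a r lam (jet z t) t := rfl

/-- Only derivatives of order at most `n - 2` enter, which is why jets of that order suffice for the
fixed point problem. -/
theorem rhsAt_congr {n : ℕ} (a : ℕ → ℂ) (r : ℕ → ℝ → ℂ) (lam : ℂ) {x y : ℕ → ℂ} (t : ℝ)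
    (h : ∀ k < n - 1, x k = y k) : rhsAt n a r lam x t = rhsAt n a r lam y t := by
  simp only [rhsAt, weighted_eq]
  congr 1
  · congr 1
    refine Finset.sum_congr rfl fun k hk => ?_
    have := Finset.mem_Icc.1 hk
    rw [h (k - 1) (by omega)]
  · refine Finset.sum_congr rfl fun i hi => ?_
    have := Finset.mem_Icc.1 hi
    rw [bellF_congr (i - 1) (fun k hk => h k (by omega))]

/-- Splitting the right hand side along `r = μ + ν` and `z = θ + ψ`. -/
theorem riccatiRHS_split {n : ℕ} (a : ℕ → ℂ) {r μ ν : ℕ → ℝ → ℂ} (lam : ℂ) {z θ ψ : ℝ → ℂ} {t : ℝ}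
    (hr : ∀ i ≤ n, r i t = μ i t + ν i t) (hz : ∀ k < n - 1, jet z t k = jet θ t k + jet ψ t k) :
    riccatiRHS n a r lam z t = riccatiRHS n a μ lam θ t + psiRHS n a r ν lam θ ψ t := by
  rw [riccatiRHS_eq_rhsAt, rhsAt_congr a r lam t (y := jet θ t + jet ψ t) hz]
  have hdP : ∀ k, dP n (fun i => r i t) k lam =
      dP n (fun i => μ i t) k lam + dP n (fun i => ν i t) k lam := fun k => by
    rw [← dP_add]; exact dP_congr hr k lam
  -- The coefficient `a + r` is split as `(a + μ) + ν` only in front of the value at `θ`; in front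
  -- of the increments in `ψ` it stays whole.
  have hF : ∀ i ∈ Finset.Icc 2 n, dP n (fun i => a i + r i t) i lam * bellF (i - 1)
      (jet θ t + jet ψ t) = dP n (fun i => a i + μ i t) i lam * bellF (i - 1) (jet θ t)
      + dP n (fun i => ν i t) i lam * bellF (i - 1) (jet θ t)
      + dP n (fun i => a i + r i t) i lam *
        ∑ k ∈ Finset.Icc 1 (i - 1), (i.choose k : ℂ) * bell (i - k) (jet θ t) * jet ψ t (k - 1)
      + dP n (fun i => a i + r i t) i lam *
        ∑ k ∈ Finset.Icc 2 i, (i.choose k : ℂ) * bell (i - k) (jet θ t) *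
          bellF (k - 1) (jet ψ t) := fun i hi => by
    rw [bellF_add (Finset.mem_Icc.1 hi).1]
    simp only [dP_add, hdP]
    ring
  simp only [rhsAt, psiRHS, riccatiRHS, opL, opF, opFnu, opLtheta, opFtheta, weighted_eq,
    ← dP_zero]
  rw [Finset.sum_congr rfl hF]
  simp only [hdP, Finset.sum_add_distrib, Pi.add_apply, mul_add, add_mul]
  simp only [jet]
  ring

/-! ### From the Riccati type equation to the linear equation -/

theorem iteratedDeriv_exp_mul (lam : ℂ) (i : ℕ) :
    iteratedDeriv i (fun t : ℝ => Complex.exp (lam * t)) =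
      fun t : ℝ => lam ^ i * Complex.exp (lam * t) := by
  induction i with
  | zero => simp
  | succ i ih =>
    rw [iteratedDeriv_succ, ih]
    ext t
    have h : HasDerivAt (fun t : ℝ => Complex.exp (lam * t)) (Complex.exp (lam * t) * lam) t := by
      have h1 : HasDerivAt (fun t : ℝ => lam * (t : ℂ)) lam t := by
        simpa using (Complex.ofRealCLM.hasDerivAt (x := t)).const_mul lam
      exact h1.cexp
    rw [(h.const_mul (lam ^ i)).deriv]
    ring

theorem contDiff_exp_mul (lam : ℂ) {k : WithTop ℕ∞} :
    ContDiff ℝ k (fun t : ℝ => Complex.exp (lam * t)) :=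
  (contDiff_const.mul Complex.ofRealCLM.contDiff).cexp

/-- Bootstrapping: `w' = z w` makes `w` one order smoother, as long as `z` permits. -/
theorem contDiff_of_hasDerivAt_mul {m : ℕ} {z w : ℝ → ℂ} (hz : ContDiff ℝ m z)
    (hw : ∀ t, HasDerivAt w (z t * w t) t) : ContDiff ℝ (m + 1 : ℕ) w := by
  have hd : deriv w = fun t => z t * w t := funext fun t => (hw t).deriv
  have key : ∀ k ≤ m + 1, ContDiff ℝ (k : ℕ) w := by
    intro k
    induction k with
    | zero =>
      exact fun _ => contDiff_zero.2
        (continuous_iff_continuousAt.2 fun t => (hw t).continuousAt)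
    | succ k ih =>
      intro hk
      have : ((k + 1 : ℕ) : WithTop ℕ∞) = (k : WithTop ℕ∞) + 1 := by push_cast; rfl
      rw [this, contDiff_succ_iff_deriv]
      refine ⟨fun t => (hw t).differentiableAt, by simp, ?_⟩
      rw [hd]
      exact (hz.of_le (by exact_mod_cast (by omega : k ≤ m))).mul (ih (by omega))
  exact key _ le_rfl

/-- Leibniz' rule for `(z w)^(i)` has the same form as the recursion defining the Bell polynomials.
-/
theorem iteratedDeriv_of_hasDerivAt_mul {m : ℕ} {z w : ℝ → ℂ} (hz : ContDiff ℝ m z)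
    (hw : ∀ t, HasDerivAt w (z t * w t) t) {i : ℕ} (hi : i ≤ m + 1) (t : ℝ) :
    iteratedDeriv i w t = bell i (jet z t) * w t := by
  have hd : deriv w = fun t => z t * w t := funext fun t => (hw t).deriv
  have hcw := contDiff_of_hasDerivAt_mul hz hw
  induction i using Nat.strong_induction_on with
  | _ i ih =>
    cases i with
    | zero => simp [bell_zero]
    | succ i =>
      rw [iteratedDeriv_succ', hd, iteratedDeriv_fun_mul
        (hz.of_le (by exact_mod_cast (by omega : i ≤ m))).contDiffAt
        (hcw.of_le (by exact_mod_cast (by omega : i ≤ m + 1))).contDiffAt, bell_succ,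
        Finset.sum_mul]
      refine Finset.sum_congr rfl fun j hj => ?_
      rw [ih (i - j) (by omega) (by omega)]
      simp only [jet]
      ring

/-- Leibniz' rule for `e^{λt} w` and an exchange of sums give `∑ c_i y^(i) = (∑_k (1/k!) ∂^k P(c;λ)
B_k(z)) y` with `c = a + r`; the bracket is the left side of the Riccati type equation. -/
theorem solvesLinear_of_solvesRiccati {n : ℕ} (hn : 2 ≤ n) {a : ℕ → ℂ} {r : ℕ → ℝ → ℂ}
    {lam : ℂ} {z y : ℝ → ℂ} (ha : a n = 1) (hrn : ∀ t, r n t = 0) (hlam : (P n a).eval lam = 0)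
    (hz : SolvesRiccati n a r lam z) (hy : ∀ t, HasDerivAt y ((lam + z t) * y t) t) :
    SolvesLinear n a r y := by
  obtain ⟨hzc, hzeq⟩ := hz
  set w : ℝ → ℂ := fun t => Complex.exp (-lam * t) * y t with hwdef
  have hyw : y = fun t : ℝ => Complex.exp (lam * t) * w t := by
    ext t
    simp only [hwdef, ← mul_assoc, ← Complex.exp_add]
    simp
  have hw : ∀ t, HasDerivAt w (z t * w t) t := by
    intro t
    have h1 : HasDerivAt (fun t : ℝ => -lam * (t : ℂ)) (-lam) t := by
      simpa using (Complex.ofRealCLM.hasDerivAt (x := t)).const_mul (-lam)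
    refine (h1.cexp.mul (hy t)).congr_deriv ?_
    simp only [hwdef]; ring
  have hn1 : n - 1 + 1 = n := by omega
  have hwc : ContDiff ℝ n w := by simpa only [hn1] using contDiff_of_hasDerivAt_mul hzc hw
  have hyc : ContDiff ℝ n y := by rw [hyw]; exact (contDiff_exp_mul lam).mul hwc
  refine ⟨hyc, fun t => ?_⟩
  set c : ℕ → ℂ := fun i => a i + r i t with hc
  have hcn : c n = 1 := by simp [hc, ha, hrn]
  have hyi : ∀ i ∈ Finset.range (n + 1), c i * iteratedDeriv i y t =
      ∑ k ∈ Finset.range (n + 1), (i.choose k : ℂ) * c i * lam ^ (i - k) *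
        bell k (jet z t) * y t := by
    intro i hi
    have hi' : i ≤ n := Nat.lt_succ_iff.1 (Finset.mem_range.1 hi)
    have e1 : iteratedDeriv i y t = ∑ k ∈ Finset.range (i + 1),
        (i.choose k : ℂ) * lam ^ (i - k) * bell k (jet z t) * y t := by
      conv_lhs => rw [hyw]
      rw [iteratedDeriv_fun_mul (contDiff_exp_mul lam).contDiffAt
        (hwc.of_le (by exact_mod_cast hi')).contDiffAt, ← Finset.sum_range_reflect]
      refine Finset.sum_congr rfl fun k hk => ?_
      have hk' : k ≤ i := Nat.lt_succ_iff.1 (Finset.mem_range.1 hk)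
      have e2 : i + 1 - 1 - k = i - k := by omega
      have e3 : i - (i - k) = k := by omega
      rw [e2, e3, iteratedDeriv_exp_mul, iteratedDeriv_of_hasDerivAt_mul hzc hw (by omega),
        Nat.choose_symm hk', congrFun hyw t]
      ring
    rw [e1, Finset.mul_sum]
    refine Finset.sum_subset_zero_on_sdiff ?_ ?_ ?_
    · intro k hk; simp only [Finset.mem_range] at *; omega
    · intro k hk
      simp only [Finset.mem_sdiff, Finset.mem_range] at hk
      rw [Nat.choose_eq_zero_of_lt (by omega)]; simp
    · intro k _; ring
  have hsum : ∑ k ∈ Finset.range (n + 1), dP n c k lam * bell k (jet z t) = 0 := by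
    have h := hzeq t
    simp only [opD, riccatiRHS, opL, opF, weighted_eq] at h
    rw [Finset.sum_range_succ', bell_zero, dP_zero]
    have hP : (P n c).eval lam = (P n fun i => r i t).eval lam := by
      rw [← dP_zero, hc, dP_add, dP_zero, hlam, dP_zero, zero_add]
    -- All sums are brought to the range `1, …, n`: the added term of the linear part is zero
    -- because `r_n = 0`, that of the nonlinear part because `f_0 = 0`.
    have hL : ∑ k ∈ Finset.Icc 1 (n - 1), dP n (fun i => r i t) k lam * iteratedDeriv (k - 1) z t
        = ∑ k ∈ Finset.Icc 1 n, dP n (fun i => r i t) k lam * iteratedDeriv (k - 1) z t := by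
      refine Finset.sum_subset (Finset.Icc_subset_Icc_right (by omega)) fun k hk hk' => ?_
      have : k = n := by simp only [Finset.mem_Icc] at hk hk'; omega
      rw [this, dP_top, hrn, zero_mul]
    have hF : ∑ i ∈ Finset.Icc 2 n, dP n (fun i => a i + r i t) i lam * bellF (i - 1) (jet z t)
        = ∑ i ∈ Finset.Icc 1 n, dP n (fun i => a i + r i t) i lam * bellF (i - 1) (jet z t) := by
      refine Finset.sum_subset (Finset.Icc_subset_Icc_left (by omega)) fun k hk hk' => ?_
      have : k = 1 := by simp only [Finset.mem_Icc] at hk hk'; omega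
      rw [this, bellF_zero, mul_zero]
    rw [hL, hF] at h
    have hB : ∑ k ∈ Finset.range n, dP n c (k + 1) lam * bell (k + 1) (jet z t) =
        ∑ k ∈ Finset.Icc 1 n, dP n c k lam * bell k (jet z t) := by
      rw [← Finset.Ico_add_one_right_eq_Icc, Finset.sum_Ico_eq_sum_range, Nat.add_sub_cancel]
      exact Finset.sum_congr rfl fun k _ => by rw [add_comm]
    have hB' : ∑ k ∈ Finset.Icc 1 n, dP n c k lam * bell k (jet z t) =
        ∑ k ∈ Finset.Icc 1 n, (dP n a k lam * iteratedDeriv (k - 1) z t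
          + dP n (fun i => r i t) k lam * iteratedDeriv (k - 1) z t
          + dP n (fun i => a i + r i t) k lam * bellF (k - 1) (jet z t)) := by
      refine Finset.sum_congr rfl fun k hk => ?_
      rw [bell_eq_add_bellF (Finset.mem_Icc.1 hk).1, hc, dP_add]
      simp only [jet]; ring
    rw [hB, hB', hP, Finset.sum_add_distrib, Finset.sum_add_distrib]
    linear_combination h
  calc iteratedDeriv n y t + ∑ i ∈ Finset.range n, (a i + r i t) * iteratedDeriv i y t
      = ∑ i ∈ Finset.range (n + 1), c i * iteratedDeriv i y t := by
        rw [Finset.sum_range_succ, hcn]; ring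
    _ = (∑ k ∈ Finset.range (n + 1), dP n c k lam * bell k (jet z t)) * y t := by
        rw [Finset.sum_congr rfl hyi, Finset.sum_comm, Finset.sum_mul]
        refine Finset.sum_congr rfl fun k _ => ?_
        rw [dP_eq, Finset.sum_mul, Finset.sum_mul]
    _ = 0 := by rw [hsum, zero_mul]

open MeasureTheory

/-! ### Green's kernel -/

theorem green_of_pos {ω : ℂ} (hω : 0 < ω.re) (t s : ℝ) :
    green ω t s = (Ioi t).indicator (fun s : ℝ => -Complex.exp (ω * ((t : ℂ) - (s : ℂ)))) s := by
  simp [green, Real.sign_of_pos hω, indicator_apply]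

theorem green_of_neg {ω : ℂ} (hω : ω.re < 0) (t s : ℝ) :
    green ω t s = (Iio t).indicator (fun s : ℝ => Complex.exp (ω * ((t : ℂ) - (s : ℂ)))) s := by
  simp [green, Real.sign_of_neg hω, indicator_apply]

/-- The modulus of the kernel depends on `Re ω` alone; hence the real exponents `α_j` in `L₀` and
`Q₀`. -/
theorem norm_green (ω : ℂ) (t s : ℝ) : ‖green ω t s‖ = ‖green (ω.re : ℂ) t s‖ := by
  simp only [green, Complex.ofReal_re]
  split_ifs
  · simp [Complex.norm_exp]
  · rfl

theorem green_translate (ω : ℂ) (t u : ℝ) : green ω t (t - u) = green ω u 0 := by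
  simp [green]

theorem norm_green_of_pos {ω : ℂ} (hω : 0 < ω.re) (t s : ℝ) :
    ‖green ω t s‖ =
      (Ioi t).indicator (fun s : ℝ => Real.exp (ω.re * t) * Real.exp (-ω.re * s)) s := by
  rw [green_of_pos hω, norm_indicator_eq_indicator_norm]
  congr 1
  ext s
  simp [Complex.norm_exp, ← Real.exp_add]
  ring

theorem norm_green_of_neg {ω : ℂ} (hω : ω.re < 0) (t s : ℝ) :
    ‖green ω t s‖ =
      (Iio t).indicator (fun s : ℝ => Real.exp (ω.re * t) * Real.exp (-ω.re * s)) s := by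
  rw [green_of_neg hω, norm_indicator_eq_indicator_norm]
  congr 1
  ext s
  simp [Complex.norm_exp, ← Real.exp_add]
  ring

theorem measurable_green (ω : ℂ) (t : ℝ) : Measurable (green ω t) := by
  refine Measurable.ite ?_ ?_ measurable_const
  · exact measurableSet_lt (by fun_prop) measurable_const
  · fun_prop

theorem integrable_norm_green {ω : ℂ} (hω : ω.re ≠ 0) (t : ℝ) :
    Integrable (fun s => ‖green ω t s‖) := by
  rcases lt_or_gt_of_ne hω with h | h
  · simp only [norm_green_of_neg h]
    rw [integrable_indicator_iff measurableSet_Iio]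
    exact ((integrableOn_exp_mul_Iic (neg_pos.2 h) t).mono_set Iio_subset_Iic_self).const_mul _
  · simp only [norm_green_of_pos h]
    rw [integrable_indicator_iff measurableSet_Ioi]
    exact (integrableOn_exp_mul_Ioi (neg_neg_of_pos h) t).const_mul _

theorem integrable_green {ω : ℂ} (hω : ω.re ≠ 0) (t : ℝ) : Integrable (green ω t) :=
  (integrable_norm_iff (measurable_green ω t).aestronglyMeasurable).1 (integrable_norm_green hω t)

theorem integral_norm_green {ω : ℂ} (hω : ω.re ≠ 0) (t : ℝ) :
    ∫ s, ‖green ω t s‖ = 1 / |ω.re| := by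
  rcases lt_or_gt_of_ne hω with h | h
  · simp only [norm_green_of_neg h]
    rw [integral_indicator measurableSet_Iio, integral_const_mul,
      ← integral_Iic_eq_integral_Iio, integral_exp_mul_Iic (neg_pos.2 h), abs_of_neg h,
      ← mul_div_assoc, ← Real.exp_add]
    simp
  · simp only [norm_green_of_pos h]
    rw [integral_indicator measurableSet_Ioi, integral_const_mul,
      integral_exp_mul_Ioi (neg_neg_of_pos h), abs_of_pos h, neg_mul, neg_div_neg_eq,
      ← mul_div_assoc, ← Real.exp_add]
    simp

theorem integrable_green_mul {ω : ℂ} (hω : ω.re ≠ 0) {f : ℝ → ℂ} (hf : f ∈ BC) (t : ℝ) :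
    Integrable (fun s => green ω t s * f s) := by
  obtain ⟨hc, K, hK⟩ := hf
  exact (integrable_green hω t).mul_bdd (c := K) hc.aestronglyMeasurable (ae_of_all _ hK)

/-- In convolution form the variable `t` enters only through a translate of `f`, which suits both
almost periodicity and limits at the ends. -/
theorem GOp_eq_integral_translate (ω : ℂ) (f : ℝ → ℂ) (t : ℝ) :
    GOp ω f t = ∫ u, green ω u 0 * f (t - u) := by
  rw [GOp, ← integral_sub_left_eq_self _ _ t]
  simp only [green_translate]

theorem integrable_green_zero {ω : ℂ} (hω : ω.re ≠ 0) : Integrable (fun u => green ω u 0) := by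
  have h := (integrable_green hω 0).comp_sub_left 0
  simpa only [green_translate] using h

/-- `G_ω[h]` solves `u' = ω u + h`. -/
theorem hasDerivAt_GOp {ω : ℂ} (hω : ω.re ≠ 0) {h : ℝ → ℂ} (hc : Continuous h)
    (hi : ∀ t, Integrable (fun s => green ω t s * h s)) (t : ℝ) :
    HasDerivAt (GOp ω h) (ω * GOp ω h t + h t) t := by
  set q : ℝ → ℂ := fun s => Complex.exp (-ω * s) * h s with hq
  have hqc : Continuous q := by fun_prop
  have hexp : ∀ t : ℝ, HasDerivAt (fun t : ℝ => Complex.exp (ω * t)) (Complex.exp (ω * t) * ω) t :=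
    fun t => by
      have h1 : HasDerivAt (fun t : ℝ => ω * (t : ℂ)) ω t := by
        simpa using (Complex.ofRealCLM.hasDerivAt (x := t)).const_mul ω
      exact h1.cexp
  have hmul : ∀ t s : ℝ, Complex.exp (ω * (t - s)) * h s = Complex.exp (ω * t) * q s := by
    intro t s
    rw [hq, ← mul_assoc, ← Complex.exp_add]
    congr 2; ring
  have hne : ∀ t : ℝ, Complex.exp (ω * t) ≠ 0 := fun t => Complex.exp_ne_zero _
  have hint : HasDerivAt (fun t => ∫ s in (0 : ℝ)..t, q s) (q t) t :=
    intervalIntegral.integral_hasDerivAt_right (hqc.intervalIntegrable _ _)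
      (hqc.stronglyMeasurableAtFilter _ _) hqc.continuousAt
  have hqt : Complex.exp (ω * t) * q t = h t := by rw [← hmul]; simp
  rcases lt_or_gt_of_ne hω with hlt | hgt
  · have e1 : ∀ t, (fun s => green ω t s * h s) =
        (Iio t).indicator (fun s => Complex.exp (ω * t) * q s) := by
      intro t; ext s
      rw [green_of_neg hlt]
      by_cases hs : s ∈ Iio t
      · simp only [indicator_of_mem hs]; exact hmul t s
      · simp only [indicator_of_notMem hs, zero_mul]
    have hqi : ∀ t, IntegrableOn q (Iic t) := by
      intro t
      have := hi t
      rw [e1, integrable_indicator_iff measurableSet_Iio] at this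
      rw [integrableOn_Iic_iff_integrableOn_Iio]
      exact (integrable_const_mul_iff (hne t).isUnit _).1 this
    -- Factoring `e^{ωt}` out leaves a constant plus an integral from `0` to `t`, to which the
    -- fundamental theorem of calculus applies.
    have e2 : GOp ω h = fun t : ℝ =>
        Complex.exp (ω * t) * ((∫ s in Iic 0, q s) + ∫ s in (0 : ℝ)..t, q s) := by
      ext t
      rw [GOp, e1, integral_indicator measurableSet_Iio, integral_const_mul,
        ← integral_Iic_eq_integral_Iio,
        ← intervalIntegral.integral_Iic_sub_Iic (hqi 0) (hqi t)]
      ring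
    have := (hexp t).mul (hint.const_add (∫ s in Iic 0, q s))
    rw [e2]
    refine this.congr_deriv ?_
    rw [hqt]; ring
  · have e1 : ∀ t, (fun s => green ω t s * h s) =
        (Ioi t).indicator (fun s => -Complex.exp (ω * t) * q s) := by
      intro t; ext s
      rw [green_of_pos hgt]
      by_cases hs : s ∈ Ioi t
      · simp only [indicator_of_mem hs, neg_mul]; rw [hmul t s]
      · simp only [indicator_of_notMem hs, zero_mul]
    have hqi : ∀ t, IntegrableOn q (Ioi t) := by
      intro t
      have := hi t
      rw [e1, integrable_indicator_iff measurableSet_Ioi] at this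
      exact (integrable_const_mul_iff (neg_ne_zero.2 (hne t)).isUnit _).1 this
    have e2 : GOp ω h = fun t : ℝ =>
        Complex.exp (ω * t) * (-(∫ s in Ioi 0, q s) + ∫ s in (0 : ℝ)..t, q s) := by
      ext t
      rw [GOp, e1, integral_indicator measurableSet_Ioi, integral_const_mul,
        ← intervalIntegral.integral_Ioi_sub_Ioi' (hqi 0) (hqi t)]
      ring
    have := (hexp t).mul (hint.const_add (-∫ s in Ioi 0, q s))
    rw [e2]
    refine this.congr_deriv ?_
    rw [hqt]; ring

theorem GOp_add {ω : ℂ} {f g : ℝ → ℂ} {t : ℝ} (hf : Integrable (fun s => green ω t s * f s))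
    (hg : Integrable (fun s => green ω t s * g s)) :
    GOp ω (fun s => f s + g s) t = GOp ω f t + GOp ω g t := by
  simp only [GOp, mul_add]
  exact integral_add hf hg

theorem Green_add {N : ℕ} {γ : Fin N → ℂ} {f g : ℝ → ℂ} {t : ℝ}
    (hf : ∀ j, Integrable (fun s => green (γ j) t s * f s))
    (hg : ∀ j, Integrable (fun s => green (γ j) t s * g s)) :
    Green γ (fun s => f s + g s) t = Green γ f t + Green γ g t := by
  simp only [Green, ← Finset.sum_add_distrib]
  exact Finset.sum_congr rfl fun j _ => by rw [GOp_add (hf j) (hg j)]; ring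

/-! ### Derivatives of `G[h]` -/

theorem iteratedDeriv_of_hasDerivAt_chain {Z : ℕ → ℝ → ℂ} (m : ℕ)
    (hZ : ∀ i < m, ∀ t, HasDerivAt (Z i) (Z (i + 1) t) t) (hc : Continuous (Z m)) :
    ContDiff ℝ m (Z 0) ∧ ∀ i ≤ m, iteratedDeriv i (Z 0) = Z i := by
  have h1 : ∀ i ≤ m, iteratedDeriv i (Z 0) = Z i := by
    intro i
    induction i with
    | zero => simp
    | succ i ih =>
      intro hi
      rw [iteratedDeriv_succ, ih (by omega)]
      exact funext fun t => (hZ i (by omega) t).deriv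
  refine ⟨?_, h1⟩
  have h2 : ∀ k i, i + k = m → ContDiff ℝ k (Z i) := by
    intro k
    induction k with
    | zero => rintro i rfl; exact contDiff_zero.2 (by simpa using hc)
    | succ k ih =>
      intro i hi
      have : ((k + 1 : ℕ) : WithTop ℕ∞) = (k : WithTop ℕ∞) + 1 := by push_cast; rfl
      rw [this, contDiff_succ_iff_deriv]
      refine ⟨fun t => (hZ i (by omega) t).differentiableAt, by simp, ?_⟩
      rw [funext fun t => (hZ i (by omega) t).deriv]
      exact ih (i + 1) (by omega)
  exact h2 m 0 (by omega)

/-- The formal `i`-th derivative of `G[h]`. -/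
def greenDeriv {N : ℕ} (γ : Fin N → ℂ) (i : ℕ) (h : ℝ → ℂ) (t : ℝ) : ℂ :=
  ∑ j, 1 / bigGamma γ j * γ j ^ i * GOp (γ j) h t

theorem greenDeriv_zero {N : ℕ} (γ : Fin N → ℂ) (h : ℝ → ℂ) : greenDeriv γ 0 h = Green γ h := by
  ext t; simp [greenDeriv, Green]

section Derivatives

variable {N : ℕ} {γ : Fin N → ℂ} {h : ℝ → ℂ}

/-- Absolute convergence is assumed instead of boundedness of `h`: in the converse part the
derivatives of `θ` and `ψ` need not be bounded. -/
theorem hasDerivAt_greenDeriv (hre : ∀ j, (γ j).re ≠ 0) (hc : Continuous h)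
    (hi : ∀ t j, Integrable (fun s => green (γ j) t s * h s)) (i : ℕ) (t : ℝ) :
    HasDerivAt (greenDeriv γ i h)
      (greenDeriv γ (i + 1) h t + (∑ j, 1 / bigGamma γ j * γ j ^ i) * h t) t := by
  have := HasDerivAt.fun_sum (u := Finset.univ) fun j _ =>
    (hasDerivAt_GOp (hre j) hc (fun t => hi t j) t).const_mul (1 / bigGamma γ j * γ j ^ i)
  refine this.congr_deriv ?_
  rw [greenDeriv, Finset.sum_mul, ← Finset.sum_add_distrib]
  exact Finset.sum_congr rfl fun j _ => by ring

/-- Differentiating the `i`-th formal derivative produces `h` with factor `∑_j γ_j^i / Γ_j`. This is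
`0` for `i < N - 1` and `1` for `i = N - 1`, so `h` first appears at order `N`. -/
theorem iteratedDeriv_Green (hN : 0 < N) (hγ : Function.Injective γ) (hre : ∀ j, (γ j).re ≠ 0)
    (hc : Continuous h) (hi : ∀ t j, Integrable (fun s => green (γ j) t s * h s)) :
    ContDiff ℝ N (Green γ h) ∧ (∀ i < N, iteratedDeriv i (Green γ h) = greenDeriv γ i h) ∧
      ∀ t, iteratedDeriv N (Green γ h) t = greenDeriv γ N h t + h t := by
  set Z : ℕ → ℝ → ℂ := fun i =>
    if i < N then greenDeriv γ i h else fun t => greenDeriv γ N h t + h t with hZ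
  have hd := hasDerivAt_greenDeriv hre hc hi
  have hZ' : ∀ i < N, ∀ t, HasDerivAt (Z i) (Z (i + 1) t) t := by
    intro i hiN t
    simp only [hZ, if_pos hiN]
    refine (hd i t).congr_deriv ?_
    rw [sum_pow_div_bigGamma hγ hiN]
    by_cases h1 : i + 1 < N
    · rw [if_pos h1, if_neg (by omega)]; simp
    · rw [if_neg h1, if_pos (by omega), one_mul, show i + 1 = N by omega]
  have hcont : Continuous (Z N) := by
    simp only [hZ, lt_irrefl, if_false]
    exact (continuous_iff_continuousAt.2 fun t => (hd N t).continuousAt).add hc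
  obtain ⟨h1, h2⟩ := iteratedDeriv_of_hasDerivAt_chain N hZ' hcont
  have hZ0 : Z 0 = Green γ h := by simp only [hZ, if_pos hN, greenDeriv_zero]
  rw [hZ0] at h1 h2
  refine ⟨h1, fun i hi' => ?_, fun t => ?_⟩
  · rw [h2 i hi'.le]; simp only [hZ, if_pos hi']
  · rw [h2 N le_rfl]; simp only [hZ, lt_irrefl, if_false]

end Derivatives

/-- A continuous solution of the integral equation solves the Riccati type equation. -/
theorem solvesRiccati_of_green {n : ℕ} (hn : 2 ≤ n) {a : ℕ → ℂ} {r : ℕ → ℝ → ℂ} {lam : ℂ}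
    {γ : Fin (n - 1) → ℂ} {z : ℝ → ℂ} (ha : a n = 1) (hlam : (P n a).eval lam = 0)
    (hroot : ∀ j, (P n a).eval (lam + γ j) = 0) (hγ : Function.Injective γ)
    (hre : ∀ j, (γ j).re ≠ 0) (hc : Continuous (riccatiRHS n a r lam z))
    (hi : ∀ t j, Integrable (fun s => green (γ j) t s * riccatiRHS n a r lam z s))
    (hz : ∀ t, z t = -Green γ (riccatiRHS n a r lam z) t) :
    SolvesRiccati n a r lam z := by
  set h := riccatiRHS n a r lam z
  obtain ⟨h1, h2, h3⟩ := iteratedDeriv_Green (by omega) hγ hre hc hi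
  have hz' : z = -Green γ h := funext hz
  refine ⟨by rw [hz']; exact h1.neg, fun t => ?_⟩
  have hne : ∀ j, γ j ≠ 0 := fun j h0 => hre j (by rw [h0]; rfl)
  -- The symbol of `D` at `γ_j`, multiplied by `γ_j`, is `P(a;λ+γ_j) - P(a;λ) = 0`.
  have hD : ∀ j, ∑ k ∈ Finset.Icc 1 n, dP n a k lam * γ j ^ (k - 1) = 0 := by
    intro j
    apply mul_right_cancel₀ (hne j)
    have := hroot j
    rw [taylor_P, Finset.sum_range_succ', dP_zero, hlam, zero_mul, add_zero] at this
    rw [zero_mul, ← this, ← Finset.Ico_add_one_right_eq_Icc, Finset.sum_Ico_eq_sum_range,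
      Nat.add_sub_cancel, Finset.sum_mul]
    refine Finset.sum_congr rfl fun k _ => ?_
    rw [Nat.add_sub_cancel_left, add_comm 1 k, pow_succ]; ring
  -- Only the derivative of order `n - 1` contributes `h`, with weight `a_n = 1`.
  have hdz : ∀ k ∈ Finset.Icc 1 n, dP n a k lam * iteratedDeriv (k - 1) z t =
      -(dP n a k lam * greenDeriv γ (k - 1) h t) - if k = n then h t else 0 := by
    intro k hk
    have hk' := Finset.mem_Icc.1 hk
    rw [hz', iteratedDeriv_neg]
    by_cases hkn : k = n
    · subst hkn
      rw [h3, dP_top, ha]; simp; ring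
    · rw [h2 (k - 1) (by omega), if_neg hkn]; ring
  have hsum : ∑ k ∈ Finset.Icc 1 n, dP n a k lam * greenDeriv γ (k - 1) h t = 0 := by
    simp only [greenDeriv, Finset.mul_sum]
    rw [Finset.sum_comm]
    refine Finset.sum_eq_zero fun j _ => ?_
    calc _ = (∑ k ∈ Finset.Icc 1 n, dP n a k lam * γ j ^ (k - 1)) *
          (1 / bigGamma γ j * GOp (γ j) h t) := by
          rw [Finset.sum_mul]; exact Finset.sum_congr rfl fun k _ => by ring
      _ = 0 := by rw [hD, zero_mul]
  rw [opD, Finset.sum_congr rfl hdz, Finset.sum_sub_distrib, Finset.sum_neg_distrib, hsum,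
    Finset.sum_ite_eq' _ n, if_pos (Finset.mem_Icc.2 ⟨by omega, le_rfl⟩)]
  ring

/-- The last exponent contributes `-G[h]` and a multiple of `h` to the logarithmic derivative; by
`sum_inv_bigGamma_mul` the middle factor cancels that multiple. -/
theorem hasDerivAt_explicitY {n : ℕ} (hn : 2 ≤ n) {γ : Fin (n - 1) → ℂ} {lam : ℂ} {h : ℝ → ℂ}
    (hγ : Function.Injective γ) (hre : ∀ j, (γ j).re ≠ 0) (hc : Continuous h)
    (hi : ∀ t j, Integrable (fun s => green (γ j) t s * h s)) (t : ℝ) :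
    HasDerivAt (explicitY n γ lam h) ((lam + -Green γ h t) * explicitY n γ lam h t) t := by
  have hne : ∀ j, γ j ≠ 0 := fun j h0 => hre j (by rw [h0]; rfl)
  have h1 : HasDerivAt (fun t : ℝ => lam * (t : ℂ)) lam t := by
    simpa using (Complex.ofRealCLM.hasDerivAt (x := t)).const_mul lam
  have h2 : HasDerivAt (fun t => ∫ s in (0 : ℝ)..t, h s) (h t) t :=
    intervalIntegral.integral_hasDerivAt_right (hc.intervalIntegrable _ _)
      (hc.stronglyMeasurableAtFilter _ _) hc.continuousAt
  have h3 := (HasDerivAt.fun_sum (u := Finset.univ) fun j _ =>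
    (hasDerivAt_GOp (hre j) hc (fun t => hi t j) t).const_mul (1 / (bigGamma γ j * γ j))).neg
  have h4 : ∑ j, 1 / (bigGamma γ j * γ j) * (γ j * GOp (γ j) h t + h t) =
      Green γ h t + (-1) ^ n * (∏ j, (γ j)⁻¹) * h t := by
    have := sum_inv_bigGamma_mul (by omega) hγ hne
    rw [show n - 1 + 1 = n by omega] at this
    rw [← this, Green, Finset.sum_mul, ← Finset.sum_add_distrib]
    refine Finset.sum_congr rfl fun j _ => ?_
    have := hne j
    have := bigGamma_ne_zero hγ j
    field_simp
  have key := (h1.cexp.mul (h2.const_mul ((-1) ^ n * ∏ j, (γ j)⁻¹)).cexp).mul h3.cexp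
  refine key.congr_deriv ?_
  rw [h4]
  simp only [explicitY, Pi.mul_apply, Pi.neg_apply]
  ring

open BoundedContinuousFunction

/-! ### Almost periodic functions inside the bounded continuous functions -/

/-- The translate `F(· + b)`. -/
def translate (b : ℝ) (F : ℝ →ᵇ ℂ) : ℝ →ᵇ ℂ :=
  F.compContinuous ⟨fun t => t + b, by fun_prop⟩

@[simp] theorem translate_apply (b : ℝ) (F : ℝ →ᵇ ℂ) (t : ℝ) : translate b F t = F (t + b) := rfl

theorem dist_translate_le (b : ℝ) (F G : ℝ →ᵇ ℂ) :
    dist (translate b F) (translate b G) ≤ dist F G :=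
  (dist_le dist_nonneg).2 fun t => dist_coe_le_dist (t + b)

/-- Bochner almost periodicity of a bounded continuous function. -/
def IsBochner (F : ℝ →ᵇ ℂ) : Prop :=
  ∀ b : ℕ → ℝ, ∃ φ : ℕ → ℕ, StrictMono φ ∧ ∃ G : ℝ →ᵇ ℂ,
    Tendsto (fun k => translate (b (φ k)) F) atTop (𝓝 G)

theorem IsBochner.coe_mem_AP {F : ℝ →ᵇ ℂ} (hF : IsBochner F) : ⇑F ∈ AP := by
  refine ⟨F.continuous, fun b => ?_⟩
  obtain ⟨φ, hφ, G, hG⟩ := hF b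
  exact ⟨φ, hφ, G, tendsto_iff_tendstoUniformly.1 hG⟩

/-- If `|f(b_k)| > k`, the translates by `b_k` have no subsequence converging at `0`. -/
theorem AP_subset_BC : AP ⊆ BC := by
  rintro f ⟨hc, hf⟩
  refine ⟨hc, ?_⟩
  by_contra! hK
  choose b hb using fun k : ℕ => hK k
  obtain ⟨φ, hφ, g, hg⟩ := hf b
  have h0 := (hg.tendsto_at 0).norm
  simp only [zero_add] at h0
  have h1 : Tendsto (fun k => ‖f (b (φ k))‖) atTop atTop :=
    tendsto_atTop_mono (fun k => (hb (φ k)).le)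
      (tendsto_natCast_atTop_atTop.comp hφ.tendsto_atTop)
  exact not_tendsto_atTop_of_tendsto_nhds h0 h1

/-- A member of `BC` as a bundled bounded continuous function. -/
def bundle (f : ℝ → ℂ) (hf : f ∈ BC) : ℝ →ᵇ ℂ :=
  ofNormedAddCommGroup f hf.1 hf.2.choose hf.2.choose_spec

@[simp] theorem coe_bundle {f : ℝ → ℂ} (hf : f ∈ BC) : ⇑(bundle f hf) = f := rfl

theorem coe_mem_BC (F : ℝ →ᵇ ℂ) : ⇑F ∈ BC := ⟨F.continuous, ‖F‖, F.norm_coe_le_norm⟩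

theorem mem_AP_iff {f : ℝ → ℂ} : f ∈ AP ↔ ∃ F : ℝ →ᵇ ℂ, IsBochner F ∧ ⇑F = f := by
  constructor
  · intro hf
    refine ⟨bundle f (AP_subset_BC hf), fun b => ?_, rfl⟩
    obtain ⟨φ, hφ, g, hg⟩ := hf.2 b
    have hgc : Continuous g := hg.continuous
      (Frequently.of_forall fun k => hf.1.comp (by fun_prop))
    obtain ⟨K, hK⟩ := (AP_subset_BC hf).2
    have hgB : g ∈ BC := ⟨hgc, K, fun t =>
      le_of_tendsto (hg.tendsto_at t).norm (Eventually.of_forall fun k => hK _)⟩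
    exact ⟨φ, hφ, bundle g hgB, tendsto_iff_tendstoUniformly.2 hg⟩
  · rintro ⟨F, hF, rfl⟩
    exact hF.coe_mem_AP

theorem IsBochner.const (c : ℂ) : IsBochner (BoundedContinuousFunction.const ℝ c) :=
  fun _ => ⟨id, strictMono_id, .const ℝ c, tendsto_const_nhds⟩

/-- Extract a subsequence for `F`, then a further one for `G`; the continuous operation passes to
the limit. -/
theorem IsBochner.comp₂ {F G : ℝ →ᵇ ℂ} (hF : IsBochner F) (hG : IsBochner G)
    {op : (ℝ →ᵇ ℂ) → (ℝ →ᵇ ℂ) → (ℝ →ᵇ ℂ)}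
    (hop : Continuous fun p : (ℝ →ᵇ ℂ) × (ℝ →ᵇ ℂ) => op p.1 p.2)
    (ht : ∀ b, translate b (op F G) = op (translate b F) (translate b G)) :
    IsBochner (op F G) := by
  intro b
  obtain ⟨φ, hφ, F', hF'⟩ := hF b
  obtain ⟨φ', hφ', G', hG'⟩ := hG (b ∘ φ)
  refine ⟨φ ∘ φ', hφ.comp hφ', op F' G', ?_⟩
  simp only [ht]
  exact (hop.tendsto (F', G')).comp ((hF'.comp hφ'.tendsto_atTop).prodMk_nhds hG')

theorem IsBochner.add {F G : ℝ →ᵇ ℂ} (hF : IsBochner F) (hG : IsBochner G) : IsBochner (F + G) :=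
  hF.comp₂ hG (op := (· + ·)) (by fun_prop) fun _ => rfl

theorem IsBochner.mul {F G : ℝ →ᵇ ℂ} (hF : IsBochner F) (hG : IsBochner G) : IsBochner (F * G) :=
  hF.comp₂ hG (op := (· * ·)) (by fun_prop) fun _ => rfl

/-- Relative compactness of the translates is total boundedness. -/
theorem isBochner_iff_totallyBounded {F : ℝ →ᵇ ℂ} :
    IsBochner F ↔ TotallyBounded (range fun b => translate b F) := by
  constructor
  · intro hF
    -- A sequence in the closure is shadowed by genuine translates at distance below `1/(k+1)`,
    -- which have a convergent subsequence.
    have hseq : IsSeqCompact (closure (range fun b => translate b F)) := by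
      intro x hx
      have : ∀ k : ℕ, ∃ b : ℝ, dist (x k) (translate b F) < 1 / ((k : ℝ) + 1) := fun k => by
        obtain ⟨_, ⟨b, rfl⟩, hb⟩ := Metric.mem_closure_iff.1 (hx k) _
          (Nat.one_div_pos_of_nat (α := ℝ))
        exact ⟨b, hb⟩
      choose b hb using this
      obtain ⟨φ, hφ, G, hG⟩ := hF b
      refine ⟨G, mem_closure_of_tendsto hG (Eventually.of_forall fun k => ⟨_, rfl⟩), φ, hφ, ?_⟩
      refine (tendsto_iff_of_dist ?_).2 hG
      refine squeeze_zero (fun _ => dist_nonneg) (fun k => (hb (φ k)).le) ?_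
      exact tendsto_one_div_add_atTop_nhds_zero_nat.comp hφ.tendsto_atTop
    exact hseq.isCompact.totallyBounded.subset subset_closure
  · intro hF b
    have hcomp : IsCompact (closure (range fun b => translate b F)) :=
      isCompact_iff_totallyBounded_isComplete.2 ⟨hF.closure, isClosed_closure.isComplete⟩
    obtain ⟨G, _, φ, hφ, hG⟩ := hcomp.tendsto_subseq (x := fun k => translate (b k) F)
      fun k => subset_closure ⟨_, rfl⟩
    exact ⟨φ, hφ, G, hG⟩

/-- Translation does not increase distances, so a finite `ε/2`-net for the translates of an
`ε/2`-close function is an `ε`-net for those of `F`. -/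
theorem isClosed_isBochner : IsClosed {F : ℝ →ᵇ ℂ | IsBochner F} := by
  refine isClosed_of_closure_subset fun F hF => ?_
  rw [mem_ofPred_eq, isBochner_iff_totallyBounded, Metric.totallyBounded_iff]
  intro ε hε
  obtain ⟨G, hG, hFG⟩ := Metric.mem_closure_iff.1 hF (ε / 2) (half_pos hε)
  obtain ⟨s, hs, hsG⟩ := Metric.totallyBounded_iff.1 (isBochner_iff_totallyBounded.1 hG) (ε / 2)
    (half_pos hε)
  refine ⟨s, hs, ?_⟩
  rintro _ ⟨b, rfl⟩
  obtain ⟨y, hy, hby⟩ := mem_iUnion₂.1 (hsG ⟨b, rfl⟩)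
  refine mem_iUnion₂.2 ⟨y, hy, ?_⟩
  rw [Metric.mem_ball] at hby ⊢
  calc _ ≤ dist (translate b F) (translate b G) + dist (translate b G) y := dist_triangle _ _ _
    _ < ε / 2 + ε / 2 := add_lt_add ((dist_translate_le b F G).trans_lt hFG) hby
    _ = ε := add_halves ε

/-- The supremum norm of an almost periodic function is attained asymptotically at `+∞`. -/
theorem IsBochner.norm_le_norm_add {F V : ℝ →ᵇ ℂ} (hF : IsBochner F)
    (hV : Tendsto V atTop (𝓝 0)) : ‖F‖ ≤ ‖F + V‖ := by
  refine (norm_le (norm_nonneg _)).2 fun t => le_of_forall_pos_le_add fun ε hε => ?_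
  -- Translates by integers converge along a subsequence, so `F(t)` is nearly repeated at `t + φ k -
  -- φ K`. These points tend to `+∞`, where `V` is negligible.
  obtain ⟨φ, hφ, G, hG⟩ := hF fun k => k
  obtain ⟨K, hK⟩ := Metric.tendsto_atTop.1 hG (ε / 4) (by positivity)
  have hsh : ∀ k ≥ K, ‖F t‖ ≤ ‖F (t + ((φ k : ℝ) - φ K))‖ + ε / 2 := by
    intro k hk
    have h1 := (dist_coe_le_dist (f := translate (φ k : ℝ) F) (g := G) (t - φ K)).trans_lt (hK k hk)
    have h2 := (dist_coe_le_dist (f := translate (φ K : ℝ) F) (g := G) (t - φ K)).trans_lt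
      (hK K le_rfl)
    simp only [translate_apply, sub_add_cancel] at h1 h2
    rw [show t - (φ K : ℝ) + φ k = t + ((φ k : ℝ) - φ K) by ring] at h1
    have h3 : dist (F t) (F (t + ((φ k : ℝ) - φ K))) < ε / 2 := by
      have := dist_triangle_right (F t) (F (t + ((φ k : ℝ) - φ K))) (G (t - φ K))
      linarith
    rw [dist_eq_norm] at h3
    have := norm_sub_norm_le (F t) (F (t + ((φ k : ℝ) - φ K)))
    linarith
  have htop : Tendsto (fun k => t + ((φ k : ℝ) - φ K)) atTop atTop := by
    refine tendsto_atTop_add_const_left _ _ (tendsto_atTop_add_const_right _ _ ?_)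
    exact tendsto_natCast_atTop_atTop.comp hφ.tendsto_atTop
  have hVt := (hV.comp htop).norm
  simp only [norm_zero] at hVt
  obtain ⟨k, hk1, hk2⟩ := ((hVt.eventually (gt_mem_nhds (half_pos hε))).and
    (eventually_ge_atTop K)).exists
  have h1 := hsh k hk2
  have h2 := (F + V).norm_coe_le_norm (t + ((φ k : ℝ) - φ K))
  have h3 := norm_sub_le ((F + V) (t + ((φ k : ℝ) - φ K))) (V (t + ((φ k : ℝ) - φ K)))
  rw [BoundedContinuousFunction.coe_add, Pi.add_apply, add_sub_cancel_right] at h3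
  simp only [Function.comp_apply] at hk1
  rw [BoundedContinuousFunction.coe_add, Pi.add_apply] at h2
  linarith

/-! ### Function classes -/

/-- Bounded continuous functions vanishing along `l`. -/
def Vanishing (l : Filter ℝ) : Set (ℝ → ℂ) := {f | f ∈ BC ∧ Tendsto f l (𝓝 0)}

/-- Bounded continuous functions that are almost periodic up to a summand vanishing along `l`. -/
def AsympAP (l : Filter ℝ) : Set (ℝ → ℂ) :=
  {f | ∃ φ ∈ AP, ∃ g ∈ Vanishing l, f = φ + g}

theorem BC0_eq : BC0 = Vanishing atTop := rfl

theorem C00_eq : C00 = Vanishing (atTop ⊔ atBot) := by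
  ext f; simp [C00, BC0, Vanishing, tendsto_sup, and_assoc]

/-- `BC` as a subalgebra of all functions. -/
def algBC : Subalgebra ℂ (ℝ → ℂ) where
  carrier := BC
  mul_mem' := fun {f g} hf hg => coe_mem_BC (bundle f hf * bundle g hg)
  add_mem' := fun {f g} hf hg => coe_mem_BC (bundle f hf + bundle g hg)
  algebraMap_mem' := fun c => coe_mem_BC (BoundedContinuousFunction.const ℝ c)

/-- `AP` as a subalgebra of all functions. -/
def algAP : Subalgebra ℂ (ℝ → ℂ) where
  carrier := AP
  mul_mem' := by
    intro f g hf hg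
    obtain ⟨F, hF, rfl⟩ := mem_AP_iff.1 hf
    obtain ⟨G, hG, rfl⟩ := mem_AP_iff.1 hg
    exact (hF.mul hG).coe_mem_AP
  add_mem' := by
    intro f g hf hg
    obtain ⟨F, hF, rfl⟩ := mem_AP_iff.1 hf
    obtain ⟨G, hG, rfl⟩ := mem_AP_iff.1 hg
    exact (hF.add hG).coe_mem_AP
  algebraMap_mem' := fun c => (IsBochner.const c).coe_mem_AP

theorem mul_mem_Vanishing {l : Filter ℝ} {f g : ℝ → ℂ} (hf : f ∈ BC) (hg : g ∈ Vanishing l) :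
    f * g ∈ Vanishing l := by
  refine ⟨algBC.mul_mem hf hg.1, ?_⟩
  obtain ⟨K, hK⟩ := hf.2
  exact isBoundedUnder_le_mul_tendsto_zero ⟨K, by simpa using Eventually.of_forall hK⟩ hg.2

/-- `Vanishing l` as a linear subspace of all functions. -/
def spaceVanishing (l : Filter ℝ) : Submodule ℂ (ℝ → ℂ) where
  carrier := Vanishing l
  zero_mem' := ⟨algBC.zero_mem, tendsto_const_nhds⟩
  add_mem' := fun {f g} hf hg => ⟨algBC.add_mem hf.1 hg.1, by
    have := hf.2.add hg.2; rwa [add_zero] at this⟩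
  smul_mem' := fun c f hf => ⟨algBC.smul_mem hf.1 c, by
    have := hf.2.const_smul c; rwa [smul_zero] at this⟩

/-- `AsympAP l` as a subalgebra of all functions. -/
def algAsympAP (l : Filter ℝ) : Subalgebra ℂ (ℝ → ℂ) where
  carrier := AsympAP l
  mul_mem' := by
    rintro _ _ ⟨φ, hφ, g, hg, rfl⟩ ⟨φ', hφ', g', hg', rfl⟩
    refine ⟨φ * φ', algAP.mul_mem hφ hφ', φ * g' + (φ' * g + g * g'), ?_, by ring⟩
    exact (spaceVanishing l).add_mem (mul_mem_Vanishing (AP_subset_BC hφ) hg')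
      ((spaceVanishing l).add_mem (mul_mem_Vanishing (AP_subset_BC hφ') hg)
        (mul_mem_Vanishing hg.1 hg'))
  add_mem' := by
    rintro _ _ ⟨φ, hφ, g, hg, rfl⟩ ⟨φ', hφ', g', hg', rfl⟩
    exact ⟨φ + φ', algAP.add_mem hφ hφ', g + g', (spaceVanishing l).add_mem hg hg', by ring⟩
  algebraMap_mem' := fun c =>
    ⟨_, algAP.algebraMap_mem c, 0, (spaceVanishing l).zero_mem, by simp⟩

theorem AsympAP_subset_BC (l : Filter ℝ) : AsympAP l ⊆ BC := by
  rintro _ ⟨φ, hφ, g, hg, rfl⟩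
  exact algBC.add_mem (AP_subset_BC hφ) hg.1

/-- Boundedness and continuity of the vanishing summand are automatic, as it equals `f - φ`. -/
theorem mem_AsympAP_iff {l : Filter ℝ} {f : ℝ → ℂ} :
    f ∈ AsympAP l ↔ f ∈ BC ∧ ∃ φ g : ℝ → ℂ, φ ∈ AP ∧ Tendsto g l (𝓝 0) ∧ ∀ t, f t = φ t + g t := by
  constructor
  · intro hf
    refine ⟨AsympAP_subset_BC l hf, ?_⟩
    obtain ⟨φ, hφ, g, hg, rfl⟩ := hf
    exact ⟨φ, g, hφ, hg.2, fun _ => rfl⟩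
  · rintro ⟨hf, φ, g, hφ, hg, h⟩
    have hfe : f = φ + g := funext h
    refine ⟨φ, hφ, g, ⟨?_, hg⟩, hfe⟩
    rw [eq_sub_of_add_eq' hfe.symm]
    exact algBC.sub_mem hf (AP_subset_BC hφ)

theorem AAP_eq : AAP = AsympAP atTop := by
  ext f; rw [mem_AsympAP_iff]; rfl

theorem AAP0_eq : AAP0 = AsympAP (atTop ⊔ atBot) := by
  ext f; rw [mem_AsympAP_iff]; simp only [AAP0, mem_ofPred_eq, tendsto_sup, and_assoc]

/-- Apply `IsBochner.norm_le_norm_add` with `-F` as the vanishing summand. -/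
theorem eq_zero_of_AP_of_Vanishing {l : Filter ℝ} (hl : atTop ≤ l) {φ : ℝ → ℂ} (hφ : φ ∈ AP)
    (hV : φ ∈ Vanishing l) : φ = 0 := by
  obtain ⟨F, hF, rfl⟩ := mem_AP_iff.1 hφ
  have hneg : Tendsto (-F : ℝ →ᵇ ℂ) atTop (𝓝 0) := by
    have := (hV.2.mono_left hl).neg; rwa [neg_zero] at this
  have := hF.norm_le_norm_add hneg
  rw [add_neg_cancel, norm_zero, norm_le_zero_iff] at this
  rw [this]; rfl

theorem decomposition_unique {l : Filter ℝ} (hl : atTop ≤ l) {φ φ' g g' : ℝ → ℂ} (hφ : φ ∈ AP)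
    (hφ' : φ' ∈ AP) (hg : g ∈ Vanishing l) (hg' : g' ∈ Vanishing l) (h : φ + g = φ' + g') :
    φ = φ' ∧ g = g' := by
  have h1 : φ - φ' = g' - g := by linear_combination h
  have h2 := eq_zero_of_AP_of_Vanishing hl (algAP.sub_mem hφ hφ')
    (h1 ▸ (spaceVanishing l).sub_mem hg' hg)
  have h3 : φ = φ' := sub_eq_zero.1 h2
  exact ⟨h3, by rw [h3] at h; exact add_left_cancel h⟩

theorem isClosed_Vanishing (l : Filter ℝ) : IsClosed {F : ℝ →ᵇ ℂ | Tendsto F l (𝓝 0)} := by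
  refine isClosed_of_closure_subset fun F hF => ?_
  rw [mem_ofPred_eq, Metric.tendsto_nhds]
  intro ε hε
  obtain ⟨G, hG, hFG⟩ := Metric.mem_closure_iff.1 hF (ε / 2) (half_pos hε)
  filter_upwards [Metric.tendsto_nhds.1 hG (ε / 2) (half_pos hε)] with t ht
  have := dist_coe_le_dist (f := F) (g := G) t
  have := dist_triangle (F t) (G t) 0
  linarith

/-- `AsympAP l` is closed under uniform limits. -/
theorem isClosed_AsympAP {l : Filter ℝ} (hl : atTop ≤ l) :
    IsClosed {F : ℝ →ᵇ ℂ | ⇑F ∈ AsympAP l} := by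
  refine isClosed_of_closure_subset fun F hF => ?_
  obtain ⟨f, hf, hfF⟩ := mem_closure_iff_seq_limit.1 hF
  have hdec : ∀ k, ∃ φ g : ℝ →ᵇ ℂ, IsBochner φ ∧ Tendsto g l (𝓝 0) ∧ f k = φ + g := by
    intro k
    obtain ⟨φ, hφ, g, hg, h⟩ := hf k
    obtain ⟨Φ, hΦ, rfl⟩ := mem_AP_iff.1 hφ
    exact ⟨Φ, bundle g hg.1, hΦ, hg.2, DFunLike.coe_injective h⟩
  choose φ g hφ hg hfk using hdec
  -- The norm inequality for almost periodic parts makes the projection onto them `1`-Lipschitz, so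
  -- they form a Cauchy sequence.
  have hdist : ∀ k m, dist (φ k) (φ m) ≤ dist (f k) (f m) := by
    intro k m
    rw [dist_eq_norm, dist_eq_norm, hfk, hfk, add_sub_add_comm]
    have hneg : IsBochner (-φ m) := by
      have := (IsBochner.const (-1)).mul (hφ m)
      convert this using 1
      ext t; simp
    have hB : IsBochner (φ k - φ m) := by rw [sub_eq_add_neg]; exact (hφ k).add hneg
    refine hB.norm_le_norm_add ?_
    have := ((hg k).sub (hg m)).mono_left hl
    rwa [sub_zero] at this
  have hcauchy : CauchySeq φ := by
    rw [Metric.cauchySeq_iff]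
    intro ε hε
    obtain ⟨K, hK⟩ := Metric.cauchySeq_iff.1 hfF.cauchySeq ε hε
    exact ⟨K, fun a ha b hb => (hdist a b).trans_lt (hK a ha b hb)⟩
  obtain ⟨Φ, hΦ⟩ := cauchySeq_tendsto_of_complete hcauchy
  have hΦB : IsBochner Φ :=
    isClosed_isBochner.mem_of_tendsto hΦ (Eventually.of_forall hφ)
  have hgF : Tendsto g atTop (𝓝 (F - Φ)) := by
    have : g = fun k => f k - φ k := funext fun k => by rw [hfk]; abel
    rw [this]
    exact hfF.sub hΦ
  have hgV : Tendsto (F - Φ : ℝ →ᵇ ℂ) l (𝓝 0) :=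
    (isClosed_Vanishing l).mem_of_tendsto hgF (Eventually.of_forall hg)
  exact ⟨Φ, hΦB.coe_mem_AP, (F - Φ : ℝ →ᵇ ℂ), ⟨coe_mem_BC _, hgV⟩, by simp⟩

/-! ### Green's operators on the function classes -/

theorem continuous_GOp {ω : ℂ} (hω : ω.re ≠ 0) {f : ℝ → ℂ} (hf : f ∈ BC) :
    Continuous (GOp ω f) :=
  continuous_iff_continuousAt.2 fun t =>
    (hasDerivAt_GOp hω hf.1 (integrable_green_mul hω hf) t).continuousAt

theorem norm_GOp_le {ω : ℂ} (hω : ω.re ≠ 0) {f : ℝ → ℂ} {K : ℝ} (hK : ∀ t, ‖f t‖ ≤ K) (t : ℝ) :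
    ‖GOp ω f t‖ ≤ 1 / |ω.re| * K := by
  rw [← integral_norm_green hω t, ← integral_mul_const]
  refine norm_integral_le_of_norm_le ((integrable_norm_green hω t).mul_const K)
    (Eventually.of_forall fun s => ?_)
  rw [norm_mul]
  gcongr
  exact hK s

theorem GOp_mem_BC {ω : ℂ} (hω : ω.re ≠ 0) {f : ℝ → ℂ} (hf : f ∈ BC) : GOp ω f ∈ BC := by
  obtain ⟨K, hK⟩ := hf.2
  exact ⟨continuous_GOp hω hf, _, norm_GOp_le hω hK⟩

/-- `G_ω` is Lipschitz for the supremum norm and commutes with translations, so it carries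
convergent sequences of translates to such sequences. -/
theorem GOp_mem_AP {ω : ℂ} (hω : ω.re ≠ 0) {f : ℝ → ℂ} (hf : f ∈ AP) : GOp ω f ∈ AP := by
  obtain ⟨F, hF, rfl⟩ := mem_AP_iff.1 hf
  set T : (ℝ →ᵇ ℂ) → (ℝ →ᵇ ℂ) := fun F => bundle (GOp ω F) (GOp_mem_BC hω (coe_mem_BC F)) with hT
  have hTl : ∀ F G, dist (T F) (T G) ≤ 1 / |ω.re| * dist F G := by
    intro F G
    refine (dist_le (by positivity)).2 fun t => ?_
    have : GOp ω F t - GOp ω G t = GOp ω (fun s => F s - G s) t := by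
      rw [GOp, GOp, GOp, ← integral_sub (integrable_green_mul hω (coe_mem_BC F) t)
        (integrable_green_mul hω (coe_mem_BC G) t)]
      simp only [mul_sub]
    rw [dist_eq_norm]
    simp only [hT, coe_bundle, this]
    exact norm_GOp_le hω (fun s => by rw [← dist_eq_norm]; exact dist_coe_le_dist s) t
  have hTc : Continuous T :=
    (LipschitzWith.of_dist_le_mul (K := ⟨1 / |ω.re|, by positivity⟩) hTl).continuous
  have hTt : ∀ b, translate b (T F) = T (translate b F) := by
    intro b
    ext t
    simp only [hT, translate_apply, coe_bundle, GOp_eq_integral_translate]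
    refine integral_congr_ae (Eventually.of_forall fun u => ?_)
    simp only
    congr 2; ring
  have hTF : IsBochner (T F) := by
    intro b
    obtain ⟨φ, hφ, G, hG⟩ := hF b
    refine ⟨φ, hφ, T G, ?_⟩
    simp only [hTt]
    exact (hTc.tendsto G).comp hG
  exact hTF.coe_mem_AP

/-- Dominated convergence in the convolution form, for which `l` has to be invariant under shifts
and countably generated. -/
theorem GOp_mem_Vanishing {l : Filter ℝ} [l.IsCountablyGenerated]
    (hl : ∀ u : ℝ, Tendsto (fun t => t - u) l l) {ω : ℂ} (hω : ω.re ≠ 0) {f : ℝ → ℂ}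
    (hf : f ∈ Vanishing l) : GOp ω f ∈ Vanishing l := by
  refine ⟨GOp_mem_BC hω hf.1, ?_⟩
  obtain ⟨hc, K, hK⟩ := hf.1
  have h0 : (0 : ℂ) = ∫ u : ℝ, green ω u 0 * 0 := by simp
  rw [funext (GOp_eq_integral_translate ω f), h0]
  refine tendsto_integral_filter_of_dominated_convergence (fun u => ‖green ω u 0‖ * K) ?_ ?_ ?_ ?_
  · exact Eventually.of_forall fun t => (integrable_green_zero hω).aestronglyMeasurable.mul
      (hc.comp (by fun_prop : Continuous fun u => t - u)).aestronglyMeasurable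
  · refine Eventually.of_forall fun t => Eventually.of_forall fun u => ?_
    rw [norm_mul]
    gcongr
    exact hK _
  · exact (integrable_green_zero hω).norm.mul_const K
  · exact Eventually.of_forall fun u => (hf.2.comp (hl u)).const_mul _

theorem greenDeriv_mem_submodule {N : ℕ} {γ : Fin N → ℂ} {h : ℝ → ℂ} (S : Submodule ℂ (ℝ → ℂ))
    (hS : ∀ j, GOp (γ j) h ∈ S) (i : ℕ) : greenDeriv γ i h ∈ S := by
  have : greenDeriv γ i h = ∑ j, (1 / bigGamma γ j * γ j ^ i) • GOp (γ j) h := by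
    ext t; simp [greenDeriv]
  rw [this]
  exact S.sum_mem fun j _ => S.smul_mem _ (hS j)

theorem greenDeriv_mem_AP {N : ℕ} {γ : Fin N → ℂ} (hre : ∀ j, (γ j).re ≠ 0) {h : ℝ → ℂ}
    (hh : h ∈ AP) (i : ℕ) : greenDeriv γ i h ∈ AP :=
  greenDeriv_mem_submodule (Subalgebra.toSubmodule algAP) (fun j => GOp_mem_AP (hre j) hh) i

theorem greenDeriv_mem_Vanishing {l : Filter ℝ} [l.IsCountablyGenerated]
    (hl : ∀ u : ℝ, Tendsto (fun t => t - u) l l) {N : ℕ} {γ : Fin N → ℂ}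
    (hre : ∀ j, (γ j).re ≠ 0) {h : ℝ → ℂ} (hh : h ∈ Vanishing l) (i : ℕ) :
    greenDeriv γ i h ∈ Vanishing l :=
  greenDeriv_mem_submodule (spaceVanishing l) (fun j => GOp_mem_Vanishing hl (hre j) hh) i

theorem greenDeriv_mem_BC {N : ℕ} {γ : Fin N → ℂ} (hre : ∀ j, (γ j).re ≠ 0) {h : ℝ → ℂ}
    (hh : h ∈ BC) (i : ℕ) : greenDeriv γ i h ∈ BC :=
  greenDeriv_mem_submodule (Subalgebra.toSubmodule algBC) (fun j => GOp_mem_BC (hre j) hh) i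

theorem greenDeriv_add {N : ℕ} {γ : Fin N → ℂ} {f g : ℝ → ℂ} {t : ℝ}
    (hf : ∀ j, Integrable (fun s => green (γ j) t s * f s))
    (hg : ∀ j, Integrable (fun s => green (γ j) t s * g s)) (i : ℕ) :
    greenDeriv γ i (fun s => f s + g s) t = greenDeriv γ i f t + greenDeriv γ i g t := by
  simp only [greenDeriv, ← Finset.sum_add_distrib]
  exact Finset.sum_congr rfl fun j _ => by rw [GOp_add (hf j) (hg j)]; ring

theorem greenDeriv_mem_AsympAP {l : Filter ℝ} [l.IsCountablyGenerated]
    (hl : ∀ u : ℝ, Tendsto (fun t => t - u) l l) {N : ℕ} {γ : Fin N → ℂ}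
    (hre : ∀ j, (γ j).re ≠ 0) {h : ℝ → ℂ} (hh : h ∈ AsympAP l) (i : ℕ) :
    greenDeriv γ i h ∈ AsympAP l := by
  obtain ⟨φ, hφ, g, hg, rfl⟩ := hh
  refine ⟨_, greenDeriv_mem_AP hre hφ i, _, greenDeriv_mem_Vanishing hl hre hg i, ?_⟩
  ext t
  exact greenDeriv_add (fun j => integrable_green_mul (hre j) (AP_subset_BC hφ) t)
    (fun j => integrable_green_mul (hre j) hg.1 t) i

/-! ### The right hand sides in function algebras -/

section Algebra

variable (S : Subalgebra ℂ (ℝ → ℂ))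

theorem fun_sum_mem {ι : Type*} (S : Submodule ℂ (ℝ → ℂ)) {s : Finset ι} {f : ι → ℝ → ℂ}
    (h : ∀ i ∈ s, f i ∈ S) : (fun t => ∑ i ∈ s, f i t) ∈ S := by
  have : (fun t => ∑ i ∈ s, f i t) = ∑ i ∈ s, f i := by ext t; simp
  rw [this]
  exact S.sum_mem h

theorem fun_const_mem (c : ℂ) : (fun _ : ℝ => c) ∈ S := S.algebraMap_mem c

theorem fun_bell_mem {x : ℕ → ℝ → ℂ} (i : ℕ) (hx : ∀ k < i, x k ∈ S) :
    (fun t => bell i (fun k => x k t)) ∈ S := by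
  induction i using Nat.strong_induction_on with
  | _ i ih =>
    cases i with
    | zero => simp only [bell_zero]; exact fun_const_mem S 1
    | succ i =>
      simp only [bell_succ]
      refine fun_sum_mem (Subalgebra.toSubmodule S) fun j hj => ?_
      have hj' := Finset.mem_range.1 hj
      exact S.mul_mem (S.mul_mem (fun_const_mem S _)
        (ih (i - j) (by omega) fun k hk => hx k (by omega))) (hx j hj')

theorem fun_bellF_mem {x : ℕ → ℝ → ℂ} (i : ℕ) (hx : ∀ k < i, x k ∈ S) :
    (fun t => bellF i (fun k => x k t)) ∈ S := by
  refine fun_sum_mem (Subalgebra.toSubmodule S) fun j hj => ?_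
  have hj' := Finset.mem_range.1 hj
  exact S.mul_mem (S.mul_mem (fun_const_mem S _) (fun_bell_mem S _ fun k hk => hx k (by omega)))
    (hx j hj')

theorem fun_dP_mem {n : ℕ} {c : ℕ → ℝ → ℂ} (hc : ∀ i ≤ n, c i ∈ S) (k : ℕ) (lam : ℂ) :
    (fun t => dP n (fun i => c i t) k lam) ∈ S := by
  simp only [dP_eq]
  refine fun_sum_mem (Subalgebra.toSubmodule S) fun i hi => ?_
  exact S.mul_mem (S.mul_mem (fun_const_mem S _) (hc i (Nat.lt_succ_iff.1 (Finset.mem_range.1 hi))))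
    (fun_const_mem S _)

/-- The right hand side is polynomial in the coefficients and the jet. An arbitrary subalgebra is
allowed, to cover bounded, almost periodic, asymptotically almost periodic and merely continuous
functions at once. -/
theorem fun_rhsAt_mem {n : ℕ} (a : ℕ → ℂ) {r : ℕ → ℝ → ℂ} (lam : ℂ) {x : ℕ → ℝ → ℂ}
    (hr : ∀ i ≤ n, r i ∈ S) (hx : ∀ k < n - 1, x k ∈ S) :
    (fun t => rhsAt n a r lam (fun k => x k t) t) ∈ S := by
  simp only [rhsAt, weighted_eq, ← dP_zero]
  refine S.add_mem (S.add_mem (fun_dP_mem S hr 0 lam) ?_) ?_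
  · refine fun_sum_mem (Subalgebra.toSubmodule S) fun k hk => ?_
    have := Finset.mem_Icc.1 hk
    exact S.mul_mem (fun_dP_mem S hr k lam) (hx (k - 1) (by omega))
  · refine fun_sum_mem (Subalgebra.toSubmodule S) fun i hi => ?_
    have := Finset.mem_Icc.1 hi
    exact S.mul_mem
      (fun_dP_mem S (c := fun i t => a i + r i t)
        (fun i hi => S.add_mem (fun_const_mem S _) (hr i hi)) i lam)
      (fun_bellF_mem S (i - 1) fun k hk => hx k (by omega))

end Algebra

theorem fun_dP_mem_Vanishing {l : Filter ℝ} {n : ℕ} {c : ℕ → ℝ → ℂ}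
    (hc : ∀ i ≤ n, c i ∈ Vanishing l) (k : ℕ) (lam : ℂ) :
    (fun t => dP n (fun i => c i t) k lam) ∈ Vanishing l := by
  simp only [dP_eq]
  refine fun_sum_mem (spaceVanishing l) fun i hi => ?_
  have h := hc i (Nat.lt_succ_iff.1 (Finset.mem_range.1 hi))
  have := (spaceVanishing l).smul_mem ((i.choose k : ℂ) * lam ^ (i - k)) h
  convert this using 1
  ext t; simp; ring

/-- Each term contains a factor from `ν` or a derivative of `ψ`, and the vanishing functions form an
ideal in `BC`. -/
theorem psiRHS_mem_Vanishing {l : Filter ℝ} {n : ℕ} (a : ℕ → ℂ) {r ν : ℕ → ℝ → ℂ} (lam : ℂ)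
    {θ ψ : ℝ → ℂ} (hr : ∀ i ≤ n, r i ∈ BC) (hν : ∀ i ≤ n, ν i ∈ Vanishing l)
    (hθ : ∀ k < n - 1, iteratedDeriv k θ ∈ BC) (hψ : ∀ k < n - 1, iteratedDeriv k ψ ∈ Vanishing l) :
    psiRHS n a r ν lam θ ψ ∈ Vanishing l := by
  have hadd := fun {f g : ℝ → ℂ} => (spaceVanishing l).add_mem (x := f) (y := g)
  have hψB : ∀ k < n - 1, iteratedDeriv k ψ ∈ BC := fun k hk => (hψ k hk).1
  have har : ∀ i ≤ n, (fun t => a i + r i t) ∈ BC := fun i hi =>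
    algBC.add_mem (fun_const_mem algBC _) (hr i hi)
  have hmul' : ∀ {f g : ℝ → ℂ}, f ∈ Vanishing l → g ∈ BC → f * g ∈ Vanishing l :=
    fun hf hg => by rw [mul_comm]; exact mul_mem_Vanishing hg hf
  have hbell : ∀ i < n, (fun t => bell i (jet θ t)) ∈ BC := fun i hi =>
    fun_bell_mem algBC (x := fun k => iteratedDeriv k θ) i fun k hk => hθ k (by omega)
  unfold psiRHS
  simp only [opL, opFnu, opLtheta, opFtheta, weighted_eq, ← dP_zero]
  refine hadd (hadd (hadd (hadd (hadd (fun_dP_mem_Vanishing hν 0 lam) ?_) ?_) ?_) ?_) ?_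
  · refine fun_sum_mem (spaceVanishing l) fun k hk => ?_
    have := Finset.mem_Icc.1 hk
    exact hmul' (fun_dP_mem_Vanishing hν k lam) (hθ (k - 1) (by omega))
  · refine fun_sum_mem (spaceVanishing l) fun i hi => ?_
    have := Finset.mem_Icc.1 hi
    exact hmul' (fun_dP_mem_Vanishing hν i lam) (fun_bellF_mem algBC
      (x := fun k => iteratedDeriv k θ) (i - 1) fun k hk => hθ k (by omega))
  · refine fun_sum_mem (spaceVanishing l) fun k hk => ?_
    have := Finset.mem_Icc.1 hk
    exact mul_mem_Vanishing (fun_dP_mem algBC hr k lam) (hψ (k - 1) (by omega))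
  · refine fun_sum_mem (spaceVanishing l) fun i hi => ?_
    have := Finset.mem_Icc.1 hi
    refine mul_mem_Vanishing (fun_dP_mem algBC har i lam) ?_
    refine fun_sum_mem (spaceVanishing l) fun k hk => ?_
    have := Finset.mem_Icc.1 hk
    exact mul_mem_Vanishing (algBC.mul_mem (fun_const_mem algBC _) (hbell (i - k) (by omega)))
      (hψ (k - 1) (by omega))
  · refine fun_sum_mem (spaceVanishing l) fun i hi => ?_
    have := Finset.mem_Icc.1 hi
    refine mul_mem_Vanishing (fun_dP_mem algBC har i lam) ?_
    refine fun_sum_mem (spaceVanishing l) fun k hk => ?_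
    have := Finset.mem_Icc.1 hk
    refine mul_mem_Vanishing (algBC.mul_mem (fun_const_mem algBC _) (hbell (i - k) (by omega))) ?_
    refine fun_sum_mem (spaceVanishing l) fun j hj => ?_
    have := Finset.mem_range.1 hj
    exact mul_mem_Vanishing (algBC.mul_mem (fun_const_mem algBC _)
      (fun_bell_mem algBC (x := fun k => iteratedDeriv k ψ) _ fun m hm => hψB m (by omega)))
      (hψ j (by omega))

/-! ### Lipschitz estimates for the nonlinear part -/

theorem ell1_nonneg (i : ℕ) (x : ℕ → ℂ) : 0 ≤ ell1 i x := Finset.sum_nonneg fun _ _ => norm_nonneg _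

theorem ell1_mono {i k : ℕ} (h : i ≤ k) (x : ℕ → ℂ) : ell1 i x ≤ ell1 k x :=
  Finset.sum_le_sum_of_subset_of_nonneg (Finset.range_subset_range.2 h) fun _ _ _ => norm_nonneg _

theorem norm_le_ell1 {i k : ℕ} (h : k < i) (x : ℕ → ℂ) : ‖x k‖ ≤ ell1 i x :=
  Finset.single_le_sum (f := fun k => ‖x k‖) (fun _ _ => norm_nonneg _) (Finset.mem_range.2 h)

/-- Boundedness and Lipschitz continuity on the `ell1`-ball of radius `δ` in `ℂ^i`. -/
def BoundedLipschitz (i : ℕ) (δ : ℝ) (F : (ℕ → ℂ) → ℂ) : Prop :=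
  (∃ K, 0 ≤ K ∧ ∀ x, ell1 i x < δ → ‖F x‖ ≤ K) ∧
    ∃ L, 0 ≤ L ∧ ∀ x y, ell1 i x < δ → ell1 i y < δ → ‖F x - F y‖ ≤ L * ell1 i (x - y)

namespace BoundedLipschitz

variable {i : ℕ} {δ : ℝ} {F G : (ℕ → ℂ) → ℂ}

theorem const (c : ℂ) : BoundedLipschitz i δ fun _ => c :=
  ⟨⟨‖c‖, norm_nonneg _, fun _ _ => le_rfl⟩, 0, le_rfl, fun _ _ _ _ => by simp⟩

theorem coord {k : ℕ} (hk : k < i) : BoundedLipschitz i δ fun x => x k := by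
  refine ⟨⟨max δ 0, le_max_right _ _, fun x hx => ?_⟩, 1, zero_le_one, fun x y _ _ => ?_⟩
  · exact ((norm_le_ell1 hk x).trans hx.le).trans (le_max_left _ _)
  · rw [one_mul]; exact norm_le_ell1 hk (x - y)

theorem add (hF : BoundedLipschitz i δ F) (hG : BoundedLipschitz i δ G) :
    BoundedLipschitz i δ fun x => F x + G x := by
  obtain ⟨⟨K, hK, hKF⟩, L, hL, hLF⟩ := hF
  obtain ⟨⟨K', hK', hKG⟩, L', hL', hLG⟩ := hG
  refine ⟨⟨K + K', by positivity, fun x hx => ?_⟩, L + L', by positivity, fun x y hx hy => ?_⟩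
  · exact (norm_add_le _ _).trans (add_le_add (hKF x hx) (hKG x hx))
  · rw [add_sub_add_comm, add_mul]
    exact (norm_add_le _ _).trans (add_le_add (hLF x y hx hy) (hLG x y hx hy))

/-- The Lipschitz constant of a product uses bounds of the factors, which is why boundedness is
carried along. -/
theorem mul (hF : BoundedLipschitz i δ F) (hG : BoundedLipschitz i δ G) :
    BoundedLipschitz i δ fun x => F x * G x := by
  obtain ⟨⟨K, hK, hKF⟩, L, hL, hLF⟩ := hF
  obtain ⟨⟨K', hK', hKG⟩, L', hL', hLG⟩ := hG
  refine ⟨⟨K * K', by positivity, fun x hx => ?_⟩, K * L' + L * K', by positivity,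
    fun x y hx hy => ?_⟩
  · rw [norm_mul]; exact mul_le_mul (hKF x hx) (hKG x hx) (norm_nonneg _) hK
  · rw [show F x * G x - F y * G y = F x * (G x - G y) + (F x - F y) * G y by ring]
    refine (norm_add_le _ _).trans ?_
    rw [norm_mul, norm_mul]
    have h0 := ell1_nonneg i (x - y)
    calc ‖F x‖ * ‖G x - G y‖ + ‖F x - F y‖ * ‖G y‖
        ≤ K * (L' * ell1 i (x - y)) + L * ell1 i (x - y) * K' := by
          gcongr
          · exact hKF x hx
          · exact hLG x y hx hy
          · exact hLF x y hx hy
          · exact hKG y hy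
      _ = (K * L' + L * K') * ell1 i (x - y) := by ring

theorem sum {ι : Type*} (s : Finset ι) {F : ι → (ℕ → ℂ) → ℂ}
    (h : ∀ k ∈ s, BoundedLipschitz i δ (F k)) : BoundedLipschitz i δ fun x => ∑ k ∈ s, F k x := by
  classical
  induction s using Finset.induction_on with
  | empty => simpa using const 0
  | insert k s hk ih =>
    simp only [Finset.sum_insert hk]
    exact (h k (Finset.mem_insert_self k s)).add
      (ih fun j hj => h j (Finset.mem_insert_of_mem hj))

theorem bell {k : ℕ} (hk : k ≤ i) : BoundedLipschitz i δ (bell k) := by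
  induction k using Nat.strong_induction_on with
  | _ k ih =>
    cases k with
    | zero => simpa only [funext bell_zero] using const 1
    | succ k =>
      rw [funext (bell_succ k)]
      refine sum _ fun j hj => ?_
      have hj' := Finset.mem_range.1 hj
      exact ((const _).mul (ih (k - j) (by omega) (by omega))).mul (coord (by omega))

theorem bellF : BoundedLipschitz i δ (bellF i) := by
  refine sum _ fun j hj => ?_
  have hj' := Finset.mem_range.1 hj
  exact ((const _).mul (bell (by omega))).mul (coord (by omega))

end BoundedLipschitz

theorem mLip_nonneg (i : ℕ) (δ : ℝ) : 0 ≤ mLip i δ := by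
  refine Real.sSup_nonneg ?_
  rintro q ⟨x, y, _, _, _, rfl⟩
  exact div_nonneg (norm_nonneg _) (ell1_nonneg _ _)

/-- The set of quotients must be shown bounded above, since otherwise the real `sSup` in `mLip` has
the default value `0`. -/
theorem norm_bellF_sub_le_of_lt {i : ℕ} {δ : ℝ} {x y : ℕ → ℂ} (hx : ell1 i x < δ)
    (hy : ell1 i y < δ) : ‖bellF i x - bellF i y‖ ≤ mLip i δ * ell1 i (x - y) := by
  by_cases hxy : ∃ k < i, x k ≠ y k
  · have hpos : 0 < ell1 i (x - y) := by
      obtain ⟨k, hk, hne⟩ := hxy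
      exact (norm_pos_iff.2 (sub_ne_zero.2 hne)).trans_le (norm_le_ell1 hk (x - y))
    rw [← div_le_iff₀ hpos]
    refine le_csSup ?_ ⟨x, y, hxy, hx, hy, rfl⟩
    obtain ⟨-, L, hL, hLF⟩ := BoundedLipschitz.bellF (i := i) (δ := δ)
    refine ⟨L, ?_⟩
    rintro q ⟨u, v, -, hu, hv, rfl⟩
    exact div_le_of_le_mul₀ (ell1_nonneg _ _) hL (hLF u v hu hv)
  · push Not at hxy
    rw [bellF_congr i hxy, sub_self, norm_zero]
    exact mul_nonneg (mLip_nonneg _ _) (ell1_nonneg _ _)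

theorem continuous_bellF_comp {x : ℕ → ℝ → ℂ} (hx : ∀ k, Continuous (x k)) (i : ℕ) :
    Continuous fun s => bellF i fun k => x k s :=
  fun_bellF_mem (continuousSubalgebra (α := ℝ) (R := ℂ) (A := ℂ)) i fun k _ => hx k

/-- The Lipschitz estimate extends to the closed ball. -/
theorem norm_bellF_sub_le {i : ℕ} {δ : ℝ} (hδ : 0 < δ) {x y : ℕ → ℂ} (hx : ell1 i x ≤ δ)
    (hy : ell1 i y ≤ δ) : ‖bellF i x - bellF i y‖ ≤ mLip i δ * ell1 i (x - y) := by
  have hscale : ∀ (s : ℝ) (u : ℕ → ℂ), ell1 i (fun k => (s : ℂ) * u k) = |s| * ell1 i u := by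
    intro s u
    simp [ell1, Finset.mul_sum]
  -- Points of the closed ball are scaled by `s < 1` into the open ball, and then `s` tends to `1`.
  -- The closed ball is needed for completeness in the fixed point argument.
  have hlim : Tendsto (fun s : ℝ => ‖bellF i (fun k => (s : ℂ) * x k) -
      bellF i (fun k => (s : ℂ) * y k)‖) (𝓝[<] 1) (𝓝 ‖bellF i x - bellF i y‖) := by
    have hc : ∀ u : ℕ → ℂ, Continuous fun s : ℝ => bellF i fun k => (s : ℂ) * u k := fun u =>
      continuous_bellF_comp (x := fun k s => (s : ℂ) * u k) (fun k => by fun_prop) i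
    have : Tendsto (fun s : ℝ => ‖bellF i (fun k => (s : ℂ) * x k) -
        bellF i (fun k => (s : ℂ) * y k)‖) (𝓝 1) (𝓝 ‖bellF i (fun k => ((1 : ℝ) : ℂ) * x k) -
        bellF i (fun k => ((1 : ℝ) : ℂ) * y k)‖) := ((hc x).sub (hc y)).norm.tendsto 1
    simp only [Complex.ofReal_one, one_mul] at this
    exact this.mono_left nhdsWithin_le_nhds
  refine le_of_tendsto hlim ?_
  filter_upwards [Ioo_mem_nhdsLT (zero_lt_one' ℝ)] with s hs
  have habs : |s| = s := abs_of_pos hs.1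
  have hlt : ∀ u : ℕ → ℂ, ell1 i u ≤ δ → ell1 i (fun k => (s : ℂ) * u k) < δ := by
    intro u hu
    rw [hscale, habs]
    nlinarith [hs.1, hs.2, ell1_nonneg i u]
  refine (norm_bellF_sub_le_of_lt (hlt x hx) (hlt y hy)).trans ?_
  have he : (fun k => (s : ℂ) * x k) - (fun k => (s : ℂ) * y k) = fun k => (s : ℂ) * (x - y) k := by
    ext k; simp [mul_sub]
  rw [he, hscale, habs]
  refine mul_le_mul_of_nonneg_left ?_ (mLip_nonneg _ _)
  nlinarith [hs.1, hs.2, ell1_nonneg i (x - y)]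

theorem mLip_le_m {n i : ℕ} (hi : 2 ≤ i) (hin : i ≤ n) (δ : ℝ) : mLip (i - 1) δ ≤ m n δ := by
  have : mLip (i - 2 + 1) δ ≤ m n δ := le_ciSup (f := fun k : Fin (n - 1) => mLip (k + 1) δ)
    (Finite.bddAbove_range _) ⟨i - 2, by omega⟩
  rwa [show i - 2 + 1 = i - 1 by omega] at this

theorem m_nonneg (n : ℕ) (δ : ℝ) : 0 ≤ m n δ := Real.iSup_nonneg fun _ => mLip_nonneg _ _

/-! ### Pointwise estimate of the right hand side -/

/-- Exchange the sums over the Taylor index `i` and the coefficient index `l`, and put `k = l - i`;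
this is the form in which `Q₀` is written. -/
theorem sum_norm_dP_le (n : ℕ) (c : ℕ → ℂ) (lam : ℂ) :
    ∑ i ∈ Finset.Icc 2 n, ‖dP n c i lam‖ ≤
      ∑ i ∈ Finset.Icc 2 n, ∑ k ∈ Finset.range (i - 1), (i.choose k : ℝ) * ‖lam‖ ^ k * ‖c i‖ := by
  have h1 : ∀ i ∈ Finset.Icc 2 n, ‖dP n c i lam‖ ≤
      ∑ l ∈ Finset.range (n + 1), (l.choose i : ℝ) * ‖lam‖ ^ (l - i) * ‖c l‖ := by
    intro i _
    rw [dP_eq]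
    refine (norm_sum_le _ _).trans (Finset.sum_le_sum fun l _ => ?_)
    rw [norm_mul, norm_mul, norm_pow, Complex.norm_natCast]
    exact le_of_eq (by ring)
  refine (Finset.sum_le_sum h1).trans (le_of_eq ?_)
  rw [Finset.sum_comm]
  symm
  refine Finset.sum_subset_zero_on_sdiff ?_ ?_ ?_
  · intro l hl; simp only [Finset.mem_Icc, Finset.mem_range] at *; omega
  · intro l hl
    simp only [Finset.mem_sdiff, Finset.mem_range, Finset.mem_Icc] at hl
    refine Finset.sum_eq_zero fun i hi => ?_
    have := Finset.mem_Icc.1 hi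
    rw [Nat.choose_eq_zero_of_lt (by omega)]; simp
  · intro l hl
    have hl' := Finset.mem_Icc.1 hl
    rw [← Finset.sum_subset (Finset.Icc_subset_Icc_right hl'.2 : Finset.Icc 2 l ⊆ _),
      ← Finset.Ico_add_one_right_eq_Icc, Finset.sum_Ico_eq_sum_range, ← Finset.sum_range_reflect,
      show l + 1 - 2 = l - 1 by omega]
    · refine Finset.sum_congr rfl fun k hk => ?_
      have hk' := Finset.mem_range.1 hk
      rw [show 2 + k = l - (l - 1 - 1 - k) by omega, Nat.choose_symm (by omega),
        show l - (l - (l - 1 - 1 - k)) = l - 1 - 1 - k by omega]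
    · intro i hi hi'
      simp only [Finset.mem_Icc] at hi hi'
      rw [Nat.choose_eq_zero_of_lt (by omega)]; simp

/-- The pointwise Lipschitz coefficient of the right hand side. -/
def lipCoeff (n : ℕ) (a : ℕ → ℂ) (r : ℕ → ℝ → ℂ) (lam : ℂ) (M : ℝ) (s : ℝ) : ℝ :=
  ∑ k ∈ Finset.Icc 1 (n - 1), 1 / (k.factorial : ℝ) *
      ‖(derivative^[k] (P n (fun i => r i s))).eval lam‖
    + M * ∑ i ∈ Finset.Icc 2 n, ∑ k ∈ Finset.range (i - 1),
      (i.choose k : ℝ) * ‖lam‖ ^ k * (‖a i‖ + ‖r i s‖)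

/-- `P(r;λ)` cancels, each jet coordinate differs by at most `D`, and each nonlinear term by at most
`m(δ) D`. -/
theorem norm_rhsAt_sub_le {n : ℕ} (a : ℕ → ℂ) (r : ℕ → ℝ → ℂ) (lam : ℂ) {δ D : ℝ} (hδ : 0 < δ)
    {x y : ℕ → ℂ} (hx : ell1 (n - 1) x ≤ δ) (hy : ell1 (n - 1) y ≤ δ)
    (hxy : ell1 (n - 1) (x - y) ≤ D) (s : ℝ) :
    ‖rhsAt n a r lam x s - rhsAt n a r lam y s‖ ≤ D * lipCoeff n a r lam (m n δ) s := by
  have hD : 0 ≤ D := (ell1_nonneg _ _).trans hxy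
  have hL : ‖∑ k ∈ Finset.Icc 1 (n - 1), dP n (fun i => r i s) k lam * (x (k - 1) - y (k - 1))‖ ≤
      D * ∑ k ∈ Finset.Icc 1 (n - 1), 1 / (k.factorial : ℝ) *
      ‖(derivative^[k] (P n (fun i => r i s))).eval lam‖ := by
    rw [Finset.mul_sum]
    refine (norm_sum_le _ _).trans (Finset.sum_le_sum fun k hk => ?_)
    have := Finset.mem_Icc.1 hk
    have h1 : ‖x (k - 1) - y (k - 1)‖ ≤ D :=
      (norm_le_ell1 (by omega : k - 1 < n - 1) (x - y)).trans hxy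
    rw [norm_mul, dP, norm_mul, norm_div, norm_one, Complex.norm_natCast, mul_comm D]
    gcongr
  have hF : ‖∑ i ∈ Finset.Icc 2 n, dP n (fun i => a i + r i s) i lam *
      (bellF (i - 1) x - bellF (i - 1) y)‖ ≤ D * (m n δ *
      ∑ i ∈ Finset.Icc 2 n, ∑ k ∈ Finset.range (i - 1),
      (i.choose k : ℝ) * ‖lam‖ ^ k * (‖a i‖ + ‖r i s‖)) := by
    calc _ ≤ ∑ i ∈ Finset.Icc 2 n, ‖dP n (fun i => a i + r i s) i lam‖ * (m n δ * D) := by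
          refine (norm_sum_le _ _).trans (Finset.sum_le_sum fun i hi => ?_)
          have hi' := Finset.mem_Icc.1 hi
          have hle : i - 1 ≤ n - 1 := by omega
          rw [norm_mul]
          refine mul_le_mul_of_nonneg_left ?_ (norm_nonneg _)
          refine (norm_bellF_sub_le hδ ((ell1_mono hle x).trans hx)
            ((ell1_mono hle y).trans hy)).trans ?_
          exact mul_le_mul (mLip_le_m hi'.1 hi'.2 δ) ((ell1_mono hle _).trans hxy)
            (ell1_nonneg _ _) (m_nonneg _ _)
      _ = D * (m n δ * ∑ i ∈ Finset.Icc 2 n, ‖dP n (fun i => a i + r i s) i lam‖) := by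
          rw [← Finset.sum_mul]; ring
      _ ≤ _ := by
          refine mul_le_mul_of_nonneg_left (mul_le_mul_of_nonneg_left ?_ (m_nonneg _ _)) hD
          refine (sum_norm_dP_le _ _ _).trans (Finset.sum_le_sum fun i _ =>
            Finset.sum_le_sum fun k _ => ?_)
          gcongr
          exact norm_add_le _ _
  have hsplit : rhsAt n a r lam x s - rhsAt n a r lam y s =
      ∑ k ∈ Finset.Icc 1 (n - 1), dP n (fun i => r i s) k lam * (x (k - 1) - y (k - 1)) +
      ∑ i ∈ Finset.Icc 2 n, dP n (fun i => a i + r i s) i lam *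
        (bellF (i - 1) x - bellF (i - 1) y) := by
    simp only [rhsAt, weighted_eq, mul_sub, Finset.sum_sub_distrib]; ring
  rw [hsplit, lipCoeff, mul_add]
  exact (norm_add_le _ _).trans (add_le_add hL hF)

/-! ### Integral estimates -/

/-- A bound is required because the real supremum of an unbounded family is `0` by default. -/
theorem le_supNorm {f : ℝ → ℝ} {K : ℝ} (hf : ∀ t, |f t| ≤ K) (t : ℝ) : f t ≤ supNorm f :=
  (le_abs_self _).trans (le_ciSup (f := fun t => |f t|) ⟨K, by rintro _ ⟨t, rfl⟩; exact hf t⟩ t)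

theorem supNorm_nonneg (f : ℝ → ℝ) : 0 ≤ supNorm f := Real.iSup_nonneg fun _ => abs_nonneg _

/-- `∫ |g_ω(t,s)| B(s) ds` exists and is at most `c`. -/
def GreenBound (ω : ℂ) (t : ℝ) (B : ℝ → ℝ) (c : ℝ) : Prop :=
  Integrable (fun s => ‖green ω t s‖ * B s) ∧ ∫ s, ‖green ω t s‖ * B s ≤ c

namespace GreenBound

variable {ω : ℂ} {t : ℝ} {B B' : ℝ → ℝ} {c c' : ℝ}

theorem add (h : GreenBound ω t B c) (h' : GreenBound ω t B' c') :
    GreenBound ω t (fun s => B s + B' s) (c + c') := by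
  simp only [GreenBound, mul_add]
  refine ⟨h.1.add h'.1, ?_⟩
  rw [integral_add h.1 h'.1]
  exact add_le_add h.2 h'.2

theorem const_mul (h : GreenBound ω t B c) {k : ℝ} (hk : 0 ≤ k) :
    GreenBound ω t (fun s => k * B s) (k * c) := by
  simp only [GreenBound, mul_left_comm _ k]
  refine ⟨h.1.const_mul k, ?_⟩
  rw [integral_const_mul]
  exact mul_le_mul_of_nonneg_left h.2 hk

theorem sum {ι : Type*} (S : Finset ι) {B : ι → ℝ → ℝ} {c : ι → ℝ}
    (h : ∀ i ∈ S, GreenBound ω t (B i) (c i)) :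
    GreenBound ω t (fun s => ∑ i ∈ S, B i s) (∑ i ∈ S, c i) := by
  simp only [GreenBound, Finset.mul_sum]
  refine ⟨integrable_finsetSum _ fun i hi => (h i hi).1, ?_⟩
  rw [integral_finsetSum _ fun i hi => (h i hi).1]
  exact Finset.sum_le_sum fun i hi => (h i hi).2

theorem const (hω : ω.re ≠ 0) (k : ℝ) : GreenBound ω t (fun _ => k) (k / |ω.re|) := by
  refine ⟨(integrable_norm_green hω t).mul_const k, ?_⟩
  rw [integral_mul_const, integral_norm_green hω]
  exact le_of_eq (by ring)

theorem norm_coe (hω : ω.re ≠ 0) {b : ℝ → ℂ} (hb : b ∈ BC) :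
    GreenBound ω t (fun s => ‖b s‖) (supNorm (IOp (ω.re : ℂ) b)) := by
  have e : ∀ t, (fun s => ‖green ω t s‖ * ‖b s‖) = fun s => ‖green (ω.re : ℂ) t s * b s‖ := by
    intro t; ext s; rw [norm_mul, norm_green]
  have hω' : ((ω.re : ℂ)).re ≠ 0 := by simpa using hω
  have hi := fun t => (integrable_green_mul hω' hb t).norm
  refine ⟨by rw [e]; exact hi t, ?_⟩
  rw [e]
  obtain ⟨K, hK⟩ := hb.2
  refine le_supNorm (K := 1 / |ω.re| * K) (f := IOp (ω.re : ℂ) b) (fun t => ?_) t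
  rw [IOp, abs_of_nonneg (integral_nonneg fun _ => norm_nonneg _), ← integral_norm_green hω t,
    ← integral_mul_const]
  refine integral_mono (hi t) ((integrable_norm_green hω t).mul_const K) fun s => ?_
  simp only [norm_mul, ← norm_green]
  gcongr
  exact hK s

theorem norm_GOp_le (h : GreenBound ω t B c) {q : ℝ → ℂ} (hq : ∀ s, ‖q s‖ ≤ B s) :
    ‖GOp ω q t‖ ≤ c := by
  refine le_trans (norm_integral_le_of_norm_le h.1 (Eventually.of_forall fun s => ?_)) h.2
  rw [norm_mul]
  gcongr
  exact hq s

end GreenBound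

section Bounds

variable {n : ℕ} {a : ℕ → ℂ} {r : ℕ → ℝ → ℂ} {lam : ℂ} {γ : Fin (n - 1) → ℂ}

/-- Integrated against `|g_ω|`, a constant `|a_i|` gives `|a_i| / |Re ω|` and `|r_i|` gives at most
the supremum of `I_{Re ω}[|r_i|]`: the two summands in `Q₀`. -/
theorem greenBound_lipCoeff (hr : ∀ i ≤ n, r i ∈ BC) {ω : ℂ} (hω : ω.re ≠ 0) {M : ℝ} (hM : 0 ≤ M)
    (t : ℝ) :
    GreenBound ω t (lipCoeff n a r lam M)
      (∑ k ∈ Finset.Icc 1 (n - 1), 1 / (k.factorial : ℝ) *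
        supNorm (IOp (ω.re : ℂ) (fun s => (derivative^[k] (P n (fun i => r i s))).eval lam))
      + M * ∑ i ∈ Finset.Icc 2 n, ∑ k ∈ Finset.range (i - 1),
      (i.choose k : ℝ) * ‖lam‖ ^ k *
        (‖a i‖ / |ω.re| + supNorm (IOp (ω.re : ℂ) (fun s => (‖r i s‖ : ℂ))))) := by
  refine GreenBound.add (GreenBound.sum _ fun k _ => ?_) (GreenBound.const_mul
    (GreenBound.sum _ fun i hi => GreenBound.sum _ fun k _ => ?_) hM)
  · refine (GreenBound.norm_coe hω ?_).const_mul (by positivity)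
    have h1 := algBC.smul_mem (fun_dP_mem algBC hr k lam) (k.factorial : ℂ)
    have h2 : (fun s => (derivative^[k] (P n (fun i => r i s))).eval lam) =
        (k.factorial : ℂ) • fun t => dP n (fun i => r i t) k lam := by
      ext s
      have : (k.factorial : ℂ) ≠ 0 := by exact_mod_cast Nat.factorial_ne_zero k
      simp only [Pi.smul_apply, smul_eq_mul, dP]
      field_simp
    rw [h2]
    exact h1
  · refine ((GreenBound.const hω _).add ?_).const_mul (by positivity)
    have hi' := Finset.mem_Icc.1 hi
    obtain ⟨hc, K, hK⟩ := hr i hi'.2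
    have := GreenBound.norm_coe (t := t) hω (b := fun s => (‖r i s‖ : ℂ))
      ⟨by fun_prop, K, fun s => by simpa using hK s⟩
    simpa using this

theorem sum_norm_greenDeriv_le (h : ℝ → ℂ) (t : ℝ) :
    ∑ i ∈ Finset.range (n - 1), ‖greenDeriv γ i h t‖ ≤
      ∑ j, alphaTilde n (γ j) / ‖bigGamma γ j‖ * ‖GOp (γ j) h t‖ := by
  calc _ ≤ ∑ i ∈ Finset.range (n - 1), ∑ j, 1 / ‖bigGamma γ j‖ * ‖γ j‖ ^ i * ‖GOp (γ j) h t‖ := by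
        refine Finset.sum_le_sum fun i _ => (norm_sum_le _ _).trans (le_of_eq ?_)
        refine Finset.sum_congr rfl fun j _ => ?_
        rw [norm_mul, norm_mul, norm_pow, norm_div, norm_one]
    _ = _ := by
        rw [Finset.sum_comm]
        refine Finset.sum_congr rfl fun j _ => ?_
        rw [alphaTilde, ← Finset.sum_mul, ← Finset.mul_sum]
        ring

theorem alphaTilde_nonneg (n : ℕ) (w : ℂ) : 0 ≤ alphaTilde n w :=
  Finset.sum_nonneg fun _ _ => by positivity

theorem L0_nonneg : 0 ≤ L0 n r lam γ :=
  Finset.sum_nonneg fun j _ => Finset.sum_nonneg fun k _ =>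
    mul_nonneg (div_nonneg (alphaTilde_nonneg _ _) (by positivity)) (supNorm_nonneg _)

theorem Q0_nonneg : 0 ≤ Q0 n a r lam γ :=
  Finset.sum_nonneg fun j _ => Finset.sum_nonneg fun i _ => Finset.sum_nonneg fun k _ =>
    mul_nonneg (mul_nonneg (mul_nonneg (div_nonneg (alphaTilde_nonneg _ _) (by positivity))
      (by positivity)) (by positivity)) (add_nonneg (by positivity) (supNorm_nonneg _))

/-- The integral operator is Lipschitz with constant `L₀ + M Q₀`. -/
theorem sum_norm_greenDeriv_le_of_lipCoeff (hr : ∀ i ≤ n, r i ∈ BC) (hre : ∀ j, (γ j).re ≠ 0)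
    {M D : ℝ} (hM : 0 ≤ M) (hD : 0 ≤ D) {q : ℝ → ℂ}
    (hq : ∀ s, ‖q s‖ ≤ D * lipCoeff n a r lam M s) (t : ℝ) :
    ∑ i ∈ Finset.range (n - 1), ‖greenDeriv γ i q t‖ ≤
      (L0 n r lam γ + M * Q0 n a r lam γ) * D := by
  refine (sum_norm_greenDeriv_le q t).trans ?_
  calc _ ≤ ∑ j, alphaTilde n (γ j) / ‖bigGamma γ j‖ * (D *
        (∑ k ∈ Finset.Icc 1 (n - 1), 1 / (k.factorial : ℝ) * supNorm (IOp ((γ j).re : ℂ)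
          (fun s => (derivative^[k] (P n (fun i => r i s))).eval lam))
        + M * ∑ i ∈ Finset.Icc 2 n, ∑ k ∈ Finset.range (i - 1), (i.choose k : ℝ) * ‖lam‖ ^ k *
        (‖a i‖ / |(γ j).re| + supNorm (IOp ((γ j).re : ℂ) (fun s => (‖r i s‖ : ℂ)))))) :=
        Finset.sum_le_sum fun j _ => mul_le_mul_of_nonneg_left
          (((greenBound_lipCoeff hr (hre j) hM t).const_mul hD).norm_GOp_le hq)
          (div_nonneg (alphaTilde_nonneg _ _) (norm_nonneg _))
    _ = _ := by
        rw [L0, Q0, Finset.mul_sum, ← Finset.sum_add_distrib, Finset.sum_mul]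
        refine Finset.sum_congr rfl fun j _ => ?_
        have e1 : ∀ k ∈ Finset.Icc 1 (n - 1), alphaTilde n (γ j) / (‖bigGamma γ j‖ * k.factorial) *
            supNorm (IOp ((γ j).re : ℂ)
              (fun s => (derivative^[k] (P n (fun i => r i s))).eval lam)) =
            alphaTilde n (γ j) / ‖bigGamma γ j‖ * (1 / (k.factorial : ℝ) *
            supNorm (IOp ((γ j).re : ℂ)
              (fun s => (derivative^[k] (P n (fun i => r i s))).eval lam))) :=
          fun k _ => by rw [← div_div]; ring
        rw [Finset.sum_congr rfl e1, ← Finset.mul_sum]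
        simp only [mul_assoc, ← Finset.mul_sum]
        ring

theorem sum_norm_greenDeriv_le_H (hn : 2 ≤ n) (hr : ∀ i ≤ n, r i ∈ BC)
    (hγ : Function.Injective γ) (hre : ∀ j, (γ j).re ≠ 0) (t : ℝ) :
    ∑ i ∈ Finset.range (n - 1),
      ‖greenDeriv γ i (fun s => (P n (fun l => r l s)).eval lam) t‖ ≤ H n r lam γ := by
  set p : ℝ → ℂ := fun s => (P n (fun l => r l s)).eval lam with hp
  have hpB : p ∈ BC := by
    have := fun_dP_mem algBC hr 0 lam
    simp only [dP_zero] at this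
    exact this
  obtain ⟨-, h2, -⟩ := iteratedDeriv_Green (by omega) hγ hre hpB.1
    fun t j => integrable_green_mul (hre j) hpB t
  have e : (fun t => ∑ i ∈ Finset.range (n - 1), ‖greenDeriv γ i p t‖) =
      fun t => ∑ i ∈ Finset.range (n - 1), ‖iteratedDeriv i (Green γ p) t‖ := by
    ext t
    exact Finset.sum_congr rfl fun i hi => by rw [h2 i (Finset.mem_range.1 hi)]
  choose K hK using fun i => (greenDeriv_mem_BC hre hpB i).2
  have hb : ∀ t, |∑ i ∈ Finset.range (n - 1), ‖greenDeriv γ i p t‖| ≤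
      ∑ i ∈ Finset.range (n - 1), K i := by
    intro t
    rw [abs_of_nonneg (Finset.sum_nonneg fun _ _ => norm_nonneg _)]
    exact Finset.sum_le_sum fun i _ => hK i t
  have := le_supNorm hb t
  rw [e] at this
  exact this

end Bounds

/-! ### The contraction -/

/-- Bounded continuous curves of jets of order `n - 2`, with the `ell1`-norm on jets. -/
abbrev JetCurve (n : ℕ) : Type := ℝ →ᵇ PiLp 1 fun _ : Fin (n - 1) => ℂ

/-- The `k`-th component of a curve of jets, extended by zero. -/
def component {n : ℕ} (Z : JetCurve n) (k : ℕ) (t : ℝ) : ℂ :=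
  if h : k < n - 1 then Z t ⟨k, h⟩ else 0

theorem ell1_component {n : ℕ} (Z : JetCurve n) (t : ℝ) :
    ell1 (n - 1) (fun k => component Z k t) = ‖Z t‖ := by
  rw [ell1, Finset.sum_range, PiLp.norm_eq_of_L1]
  exact Finset.sum_congr rfl fun k _ => by simp [component]

theorem ell1_component_sub {n : ℕ} (Z W : JetCurve n) (t : ℝ) :
    ell1 (n - 1) ((fun k => component Z k t) - fun k => component W k t) = ‖Z t - W t‖ := by
  rw [ell1, Finset.sum_range, PiLp.norm_eq_of_L1]
  exact Finset.sum_congr rfl fun k _ => by simp [component]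

/-- The bounded continuous function given by one coordinate of a curve of jets. -/
def coordinate {n : ℕ} (i : Fin (n - 1)) : JetCurve n →L[ℂ] (ℝ →ᵇ ℂ) :=
  (PiLp.proj (𝕜 := ℂ) 1 (fun _ : Fin (n - 1) => ℂ) i).compLeftContinuousBounded ℝ

theorem coordinate_apply {n : ℕ} (i : Fin (n - 1)) (Z : JetCurve n) (t : ℝ) :
    coordinate i Z t = Z t i := rfl

theorem component_eq_coordinate {n : ℕ} (Z : JetCurve n) {k : ℕ} (hk : k < n - 1) :
    component Z k = coordinate ⟨k, hk⟩ Z := by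
  ext t; simp [component, hk, coordinate_apply]

theorem component_mem_BC {n : ℕ} (Z : JetCurve n) {k : ℕ} (hk : k < n - 1) :
    component Z k ∈ BC := by
  rw [component_eq_coordinate Z hk]; exact coe_mem_BC _

/-- Assemble a curve of jets from its components. -/
def assemble (n : ℕ) (u : ℕ → ℝ → ℂ) (hu : ∀ k, u k ∈ BC) : JetCurve n :=
  ofNormedAddCommGroup (fun t => WithLp.toLp 1 fun i : Fin (n - 1) => u i t)
    ((PiLp.continuous_toLp 1 _).comp (continuous_pi fun i => (hu i).1))
    (∑ i : Fin (n - 1), (hu i).2.choose) fun t => by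
      rw [PiLp.norm_eq_of_L1]
      exact Finset.sum_le_sum fun i _ => (hu i).2.choose_spec t

theorem component_assemble {n : ℕ} {u : ℕ → ℝ → ℂ} (hu : ∀ k, u k ∈ BC) {k : ℕ} (hk : k < n - 1) :
    component (assemble n u hu) k = u k := by
  ext t; simp only [component, hk, dif_pos]; rfl

theorem norm_assemble_apply {n : ℕ} {u : ℕ → ℝ → ℂ} (hu : ∀ k, u k ∈ BC) (t : ℝ) :
    ‖assemble n u hu t‖ = ∑ k ∈ Finset.range (n - 1), ‖u k t‖ := by
  rw [← ell1_component, ell1]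
  exact Finset.sum_congr rfl fun k hk => by
    rw [component_assemble hu (Finset.mem_range.1 hk)]

theorem norm_assemble_sub_apply {n : ℕ} {u v : ℕ → ℝ → ℂ} (hu : ∀ k, u k ∈ BC)
    (hv : ∀ k, v k ∈ BC) (t : ℝ) :
    ‖assemble n u hu t - assemble n v hv t‖ = ∑ k ∈ Finset.range (n - 1), ‖u k t - v k t‖ := by
  rw [← ell1_component_sub, ell1]
  exact Finset.sum_congr rfl fun k hk => by
    rw [Pi.sub_apply, component_assemble hu (Finset.mem_range.1 hk),
      component_assemble hv (Finset.mem_range.1 hk)]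

theorem greenDeriv_sub {N : ℕ} {γ : Fin N → ℂ} {f g : ℝ → ℂ} (hre : ∀ j, (γ j).re ≠ 0)
    (hf : f ∈ BC) (hg : g ∈ BC) (i : ℕ) (t : ℝ) :
    greenDeriv γ i f t - greenDeriv γ i g t = greenDeriv γ i (fun s => f s - g s) t := by
  have h := greenDeriv_add (γ := γ) (t := t) (f := fun s => f s - g s) (g := g)
    (fun j => integrable_green_mul (hre j) (algBC.sub_mem hf hg) t)
    (fun j => integrable_green_mul (hre j) hg t) i
  simp only [sub_add_cancel] at h
  exact sub_eq_of_eq_add h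

section Contraction

variable {n : ℕ} {a : ℕ → ℂ} {r : ℕ → ℝ → ℂ} {lam : ℂ} {γ : Fin (n - 1) → ℂ}

/-- The right hand side along a curve of jets. -/
def rhsAlong (a : ℕ → ℂ) (r : ℕ → ℝ → ℂ) (lam : ℂ) (Z : JetCurve n) (t : ℝ) : ℂ :=
  rhsAt n a r lam (fun k => component Z k t) t

theorem rhsAlong_mem (S : Subalgebra ℂ (ℝ → ℂ)) (hr : ∀ i ≤ n, r i ∈ S) {Z : JetCurve n}
    (hZ : ∀ k < n - 1, component Z k ∈ S) : rhsAlong a r lam Z ∈ S :=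
  fun_rhsAt_mem S a lam hr hZ

theorem rhsAlong_mem_BC (hr : ∀ i ≤ n, r i ∈ BC) (Z : JetCurve n) : rhsAlong a r lam Z ∈ BC :=
  rhsAlong_mem algBC hr fun _ hk => component_mem_BC Z hk

theorem rhsAlong_zero (t : ℝ) :
    rhsAlong a r lam (0 : JetCurve n) t = (P n (fun l => r l t)).eval lam := by
  have h0 : (fun k => component (0 : JetCurve n) k t) = 0 := by
    ext k; simp [component]
  rw [rhsAlong, h0]
  simp [rhsAt, weighted_eq, bellF_apply_zero]

theorem neg_greenDeriv_mem_BC (hr : ∀ i ≤ n, r i ∈ BC) (hre : ∀ j, (γ j).re ≠ 0) (Z : JetCurve n)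
    (k : ℕ) : (fun t => -greenDeriv γ k (rhsAlong a r lam Z) t) ∈ BC :=
  algBC.neg_mem (greenDeriv_mem_BC hre (rhsAlong_mem_BC hr Z) k)

/-- The integral operator on curves of jets. -/
def integralOp (hr : ∀ i ≤ n, r i ∈ BC) (hre : ∀ j, (γ j).re ≠ 0) (a : ℕ → ℂ) (lam : ℂ)
    (Z : JetCurve n) : JetCurve n :=
  assemble n (fun k t => -greenDeriv γ k (rhsAlong a r lam Z) t) (neg_greenDeriv_mem_BC hr hre Z)

theorem norm_integralOp_sub_le (hr : ∀ i ≤ n, r i ∈ BC) (hre : ∀ j, (γ j).re ≠ 0) {δ : ℝ}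
    (hδ : 0 < δ) {Z W : JetCurve n} (hZ : ‖Z‖ ≤ δ) (hW : ‖W‖ ≤ δ) (t : ℝ) :
    ‖integralOp hr hre a lam Z t - integralOp hr hre a lam W t‖ ≤
      (L0 n r lam γ + m n δ * Q0 n a r lam γ) * ‖Z - W‖ := by
  rw [integralOp, integralOp, norm_assemble_sub_apply]
  have e : ∀ k ∈ Finset.range (n - 1), ‖-greenDeriv γ k (rhsAlong a r lam Z) t -
      -greenDeriv γ k (rhsAlong a r lam W) t‖ =
      ‖greenDeriv γ k (fun s => rhsAlong a r lam Z s - rhsAlong a r lam W s) t‖ := fun k _ => by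
    rw [← greenDeriv_sub hre (rhsAlong_mem_BC hr Z) (rhsAlong_mem_BC hr W), ← norm_neg]
    congr 1; ring
  rw [Finset.sum_congr rfl e]
  refine sum_norm_greenDeriv_le_of_lipCoeff hr hre (m_nonneg _ _) (norm_nonneg _) (fun s => ?_) t
  refine norm_rhsAt_sub_le a r lam hδ ?_ ?_ ?_ s
  · rw [ell1_component]; exact (Z.norm_coe_le_norm s).trans hZ
  · rw [ell1_component]; exact (W.norm_coe_le_norm s).trans hW
  · rw [ell1_component_sub]; exact (Z - W).norm_coe_le_norm s

theorem exists_fixed_jetCurve (hn : 2 ≤ n) {l : Filter ℝ} [l.IsCountablyGenerated]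
    (hl : atTop ≤ l) (hsh : ∀ u : ℝ, Tendsto (fun t => t - u) l l)
    (hr : ∀ i ≤ n, r i ∈ AsympAP l) (hγ : Function.Injective γ) (hre : ∀ j, (γ j).re ≠ 0)
    (hsmall : Smallness n a r lam γ) :
    ∃ Z : JetCurve n, (∀ k < n - 1, component Z k ∈ AsympAP l) ∧
      ∀ k < n - 1, ∀ t, component Z k t = -greenDeriv γ k (rhsAlong a r lam Z) t := by
  have hrB : ∀ i ≤ n, r i ∈ BC := fun i hi => AsympAP_subset_BC l (hr i hi)
  -- The radius `δ` is the point of `(0, δ₀)` where the maximum is attained.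
  obtain ⟨-, δ₀, -, hm, -, K, ⟨⟨δ, hδ, rfl⟩, -⟩, hH⟩ := hsmall
  obtain ⟨hmpos, hmlt⟩ := hm δ hδ
  have hδ0 : 0 < δ := hδ.1
  set q : ℝ := L0 n r lam γ + m n δ * Q0 n a r lam γ with hq
  have hq0 : 0 ≤ q := add_nonneg L0_nonneg (mul_nonneg (m_nonneg _ _) Q0_nonneg)
  have hq1 : q < 1 := by
    -- If `Q₀` were `0`, the quotient `(1 - L₀)/Q₀` would be `0` by convention, contradicting `0 <
    -- m(δ) < (1 - L₀)/Q₀`.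
    have hQ : 0 < Q0 n a r lam γ := by
      refine lt_of_le_of_ne Q0_nonneg fun h0 => ?_
      rw [← h0, div_zero] at hmlt
      exact lt_asymm hmlt hmpos
    have := (lt_div_iff₀ hQ).1 hmlt
    linarith
  set T := integralOp hrB hre a lam with hT
  set s : Set (JetCurve n) := {Z | ‖Z‖ ≤ δ ∧ ∀ i, ⇑(coordinate i Z) ∈ AsympAP l} with hs
  have hs_closed : IsClosed s := by
    have h1 : IsClosed {Z : JetCurve n | ‖Z‖ ≤ δ} := isClosed_le continuous_norm continuous_const
    have h2 : IsClosed {Z : JetCurve n | ∀ i, ⇑(coordinate i Z) ∈ AsympAP l} := by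
      have : {Z : JetCurve n | ∀ i, ⇑(coordinate i Z) ∈ AsympAP l} =
          ⋂ i, coordinate i ⁻¹' {F : ℝ →ᵇ ℂ | ⇑F ∈ AsympAP l} := by
        ext Z; simp
      rw [this]
      exact isClosed_iInter fun i => (isClosed_AsympAP hl).preimage (coordinate i).continuous
    exact h1.inter h2
  have hzero : (0 : JetCurve n) ∈ s :=
    ⟨by rw [norm_zero]; exact hδ0.le, fun i => by
      rw [map_zero]; exact (algAsympAP l).zero_mem⟩
  have hmem : ∀ Z ∈ s, ∀ k < n - 1, component Z k ∈ AsympAP l := fun Z hZ k hk => by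
    rw [component_eq_coordinate Z hk]; exact hZ.2 _
  have hcomp : ∀ Z, ∀ k < n - 1, component (T Z) k =
      fun t => -greenDeriv γ k (rhsAlong a r lam Z) t := fun Z k hk => component_assemble _ hk
  have hmaps : MapsTo T s s := by
    intro Z hZ
    refine ⟨(norm_le hδ0.le).2 fun t => ?_, fun i => ?_⟩
    -- Comparison with the image of the origin: `‖T Z‖ ≤ q δ + H ≤ q δ + (1 - q) δ = δ`.
    · have h1 := norm_integralOp_sub_le hrB hre hδ0 hZ.1 hzero.1 (a := a) (lam := lam) t
      have h2 : ‖T 0 t‖ ≤ H n r lam γ := by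
        rw [hT, integralOp, norm_assemble_apply]
        simp only [norm_neg, funext (rhsAlong_zero (n := n) (a := a) (r := r) (lam := lam))]
        exact sum_norm_greenDeriv_le_H hn hrB hγ hre t
      have h3 : ‖T Z t‖ ≤ ‖T Z t - T 0 t‖ + ‖T 0 t‖ := by
        simpa using norm_add_le (T Z t - T 0 t) (T 0 t)
      rw [sub_zero] at h1
      have h4 : q * ‖Z‖ ≤ q * δ := mul_le_mul_of_nonneg_left hZ.1 hq0
      have h5 : (1 - L0 n r lam γ - m n δ * Q0 n a r lam γ) * δ = δ - q * δ := by rw [hq]; ring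
      simp only [h5] at hH
      linarith
    · rw [← component_eq_coordinate (T Z) i.2, hcomp Z i i.2]
      exact (algAsympAP l).neg_mem (greenDeriv_mem_AsympAP hsh hre
        (rhsAlong_mem (algAsympAP l) hr (hmem Z hZ)) i)
  have hcontr : ContractingWith ⟨q, hq0⟩ (hmaps.restrict T s s) := by
    refine ⟨by exact_mod_cast hq1, LipschitzWith.of_dist_le_mul fun Z W => ?_⟩
    rw [Subtype.dist_eq, Subtype.dist_eq, dist_eq_norm Z.1]
    exact (dist_le (mul_nonneg hq0 (norm_nonneg _))).2 fun t => by
      rw [dist_eq_norm]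
      exact norm_integralOp_sub_le hrB hre hδ0 Z.2.1 W.2.1 t
  obtain ⟨Z, hZs, hfix, -⟩ := hcontr.exists_fixedPoint' hs_closed.isComplete hmaps hzero
    (edist_ne_top _ _)
  refine ⟨Z, hmem Z hZs, fun k hk t => ?_⟩
  have := congrFun (hcomp Z k hk) t
  rwa [hfix.eq] at this

end Contraction

/-! ### Solutions of the integral equations -/

section Main

variable {n : ℕ} {a : ℕ → ℂ} {r : ℕ → ℝ → ℂ} {lam : ℂ} {γ : Fin (n - 1) → ℂ} {l : Filter ℝ}

theorem neg_Green_derivatives (hn : 2 ≤ n) (hγ : Function.Injective γ) (hre : ∀ j, (γ j).re ≠ 0)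
    {h : ℝ → ℂ} (hh : h ∈ BC) :
    ContDiff ℝ (n - 1 : ℕ) (fun t => -Green γ h t) ∧ ∀ k < n - 1,
      iteratedDeriv k (fun t => -Green γ h t) = fun t => -greenDeriv γ k h t := by
  obtain ⟨h1, h2, -⟩ := iteratedDeriv_Green (by omega) hγ hre hh.1
    fun t j => integrable_green_mul (hre j) hh t
  refine ⟨h1.neg, fun k hk => ?_⟩
  ext t
  rw [iteratedDeriv_fun_neg, h2 k hk]

theorem neg_Green_mem_DerivsIn (hn : 2 ≤ n) (hγ : Function.Injective γ)
    (hre : ∀ j, (γ j).re ≠ 0) {h : ℝ → ℂ} (hh : h ∈ BC) (S : Submodule ℂ (ℝ → ℂ))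
    (hS : ∀ k, greenDeriv γ k h ∈ S) : (fun t => -Green γ h t) ∈ DerivsIn S (n - 2) := by
  obtain ⟨h1, h2⟩ := neg_Green_derivatives hn hγ hre hh
  refine ⟨h1.of_le (by exact_mod_cast (by omega : n - 2 ≤ n - 1)), fun i hi => ?_⟩
  rw [h2 i (by omega)]
  exact S.neg_mem (hS i)

theorem mem_AsympAP_of_lt (hr : ∀ i < n, r i ∈ AsympAP l) (hrn : ∀ t, r n t = 0) :
    ∀ i ≤ n, r i ∈ AsympAP l := by
  intro i hi
  rcases hi.lt_or_eq with h | rfl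
  · exact hr i h
  · rw [show r i = 0 from funext hrn]; exact (algAsympAP l).zero_mem

theorem Decomposes.mem_le {μ ν : ℕ → ℝ → ℂ} (h : Decomposes n (Vanishing l) r μ ν)
    (hrn : ∀ t, r n t = 0) :
    ∀ i ≤ n, μ i ∈ AP ∧ ν i ∈ Vanishing l ∧ ∀ t, r i t = μ i t + ν i t := by
  intro i hi
  rcases hi.lt_or_eq with h' | rfl
  · exact h.1 i h'
  · rw [show μ i = 0 from funext h.2.1, show ν i = 0 from funext h.2.2]
    exact ⟨algAP.zero_mem, (spaceVanishing l).zero_mem, fun t => by simp [hrn]⟩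

theorem exists_solution [l.IsCountablyGenerated] (hn : 2 ≤ n) (hl : atTop ≤ l)
    (hsh : ∀ u : ℝ, Tendsto (fun t => t - u) l l) (ha : a n = 1) (hrn : ∀ t, r n t = 0)
    (hlam : (P n a).eval lam = 0) (hroot : ∀ j, (P n a).eval (lam + γ j) = 0)
    (hγ : Function.Injective γ) (hre : ∀ j, (γ j).re ≠ 0) (hr : ∀ i < n, r i ∈ AsympAP l)
    (hsmall : Smallness n a r lam γ) :
    ∃ y z : ℝ → ℂ,
      SolvesLinear n a r y ∧
      (∀ t, y t = explicitY n γ lam (riccatiRHS n a r lam z) t) ∧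
      SolvesRiccati n a r lam z ∧
      z ∈ DerivsIn (AsympAP l) (n - 2) ∧
      ∀ μ ν : ℕ → ℝ → ℂ, Decomposes n (Vanishing l) r μ ν →
        ∃ θ ψ : ℝ → ℂ,
          (∀ t, z t = θ t + ψ t) ∧
          θ ∈ DerivsIn AP (n - 2) ∧
          ψ ∈ DerivsIn (Vanishing l) (n - 2) ∧
          SolvesGreen γ θ (riccatiRHS n a μ lam θ) ∧
          SolvesGreen γ ψ (psiRHS n a r ν lam θ ψ) := by
  have hr' := mem_AsympAP_of_lt hr hrn
  have hrB : ∀ i ≤ n, r i ∈ BC := fun i hi => AsympAP_subset_BC l (hr' i hi)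
  obtain ⟨Z, hZA, hZ⟩ := exists_fixed_jetCurve hn hl hsh hr' hγ hre hsmall
  set h : ℝ → ℂ := rhsAlong a r lam Z with hh
  have hhA : h ∈ AsympAP l := rhsAlong_mem (algAsympAP l) hr' hZA
  have hhB : h ∈ BC := AsympAP_subset_BC l hhA
  have hint : ∀ {f : ℝ → ℂ}, f ∈ BC → ∀ t j, Integrable (fun s => green (γ j) t s * f s) :=
    fun hf t j => integrable_green_mul (hre j) hf t
  set z : ℝ → ℂ := fun t => -Green γ h t with hz
  obtain ⟨-, hzd⟩ := neg_Green_derivatives hn hγ hre hhB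
  -- The components of the fixed point are a priori unrelated functions; the formulas for the
  -- derivatives of `-G[h]` identify them with the derivatives of `z`.
  have hric : riccatiRHS n a r lam z = h := by
    ext t
    rw [riccatiRHS_eq_rhsAt, hh]
    refine rhsAt_congr a r lam t fun k hk => ?_
    rw [hZ k hk]
    exact congrFun (hzd k hk) t
  have hzR : SolvesRiccati n a r lam z :=
    solvesRiccati_of_green hn ha hlam hroot hγ hre (by rw [hric]; exact hhB.1)
      (by rw [hric]; exact hint hhB) (by rw [hric]; exact fun t => rfl)
  refine ⟨explicitY n γ lam h, z, ?_, fun t => by rw [hric], hzR, ?_, fun μ ν hdec => ?_⟩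
  · exact solvesLinear_of_solvesRiccati hn ha hrn hlam hzR
      (hasDerivAt_explicitY hn hγ hre hhB.1 (hint hhB))
  · exact neg_Green_mem_DerivsIn hn hγ hre hhB (Subalgebra.toSubmodule (algAsympAP l))
      fun k => greenDeriv_mem_AsympAP hsh hre hhA k
  · have hdec' := hdec.mem_le hrn
    -- `θ` and `ψ` are built from a splitting of `h` alone; `μ` and `ν` enter only when `h₁` and
    -- `h₂` are identified.
    obtain ⟨h₁, hh₁, h₂, hh₂, hsum⟩ := hhA
    have hh₁B := AP_subset_BC hh₁
    set θ : ℝ → ℂ := fun t => -Green γ h₁ t with hθ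
    set ψ : ℝ → ℂ := fun t => -Green γ h₂ t with hψ
    have hθD : θ ∈ DerivsIn AP (n - 2) := neg_Green_mem_DerivsIn hn hγ hre hh₁B
      (Subalgebra.toSubmodule algAP) fun k => greenDeriv_mem_AP hre hh₁ k
    have hψD : ψ ∈ DerivsIn (Vanishing l) (n - 2) := neg_Green_mem_DerivsIn hn hγ hre hh₂.1
      (spaceVanishing l) fun k => greenDeriv_mem_Vanishing hsh hre hh₂ k
    have hderiv : ∀ k t, greenDeriv γ k h t = greenDeriv γ k h₁ t + greenDeriv γ k h₂ t := by
      intro k t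
      rw [hsum]
      exact greenDeriv_add (hint hh₁B t) (hint hh₂.1 t) k
    have hjet : ∀ t, ∀ k < n - 1, jet z t k = jet θ t k + jet ψ t k := by
      intro t k hk
      obtain ⟨-, e1⟩ := neg_Green_derivatives hn hγ hre hh₁B
      obtain ⟨-, e2⟩ := neg_Green_derivatives hn hγ hre hh₂.1
      simp only [jet, hz, hθ, hψ, hzd k hk, e1 k hk, e2 k hk, hderiv]
      ring
    have hθA : riccatiRHS n a μ lam θ ∈ AP :=
      fun_rhsAt_mem algAP a lam (x := fun k => iteratedDeriv k θ) (fun i hi => (hdec' i hi).1)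
        fun k hk => hθD.2 k (by omega)
    have hψV : psiRHS n a r ν lam θ ψ ∈ Vanishing l :=
      psiRHS_mem_Vanishing a lam hrB (fun i hi => (hdec' i hi).2.1)
        (fun k hk => AP_subset_BC (hθD.2 k (by omega))) fun k hk => hψD.2 k (by omega)
    have hsplit : h₁ + h₂ = riccatiRHS n a μ lam θ + psiRHS n a r ν lam θ ψ := by
      rw [← hsum, ← hric]
      ext t
      exact riccatiRHS_split a lam (fun i hi => (hdec' i hi).2.2 t) (hjet t)
    obtain ⟨e1, e2⟩ := decomposition_unique hl hh₁ hθA hh₂ hψV hsplit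
    refine ⟨θ, ψ, fun t => ?_, hθD, hψD, fun t => ?_, fun t => ?_⟩
    · have := hjet t 0 (by omega)
      simpa [jet] using this
    · rw [← e1]; exact ⟨hint hh₁B t, rfl⟩
    · rw [← e2]; exact ⟨hint hh₂.1 t, rfl⟩

theorem DerivsIn_add {θ ψ : ℝ → ℂ} {k : ℕ} (hθ : θ ∈ DerivsIn AP k)
    (hψ : ψ ∈ DerivsIn (Vanishing l) k) : (fun t => θ t + ψ t) ∈ DerivsIn (AsympAP l) k := by
  refine ⟨hθ.1.add hψ.1, fun i hi => ⟨_, hθ.2 i hi, _, hψ.2 i hi, ?_⟩⟩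
  ext t
  have hi' : (i : WithTop ℕ∞) ≤ (k : WithTop ℕ∞) := by exact_mod_cast hi
  exact iteratedDeriv_fun_add (hθ.1.of_le hi').contDiffAt (hψ.1.of_le hi').contDiffAt

/-- The sum of the two integral equations is `z = -G[h(z)]`, by linearity of `G` where the integrals
converge. Continuity of `h(z)` is then enough. -/
theorem solves_of_solvesGreen (hn : 2 ≤ n) (ha : a n = 1) (hrn : ∀ t, r n t = 0)
    (hlam : (P n a).eval lam = 0) (hroot : ∀ j, (P n a).eval (lam + γ j) = 0)
    (hγ : Function.Injective γ) (hre : ∀ j, (γ j).re ≠ 0) (hr : ∀ i ≤ n, Continuous (r i))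
    {μ ν : ℕ → ℝ → ℂ} (hdec : ∀ i ≤ n, ∀ t, r i t = μ i t + ν i t) {θ ψ : ℝ → ℂ}
    (hθ : ContDiff ℝ (n - 2 : ℕ) θ) (hψ : ContDiff ℝ (n - 2 : ℕ) ψ)
    (hθG : SolvesGreen γ θ (riccatiRHS n a μ lam θ))
    (hψG : SolvesGreen γ ψ (psiRHS n a r ν lam θ ψ)) :
    SolvesRiccati n a r lam (fun t => θ t + ψ t) ∧
      SolvesLinear n a r
        (fun t => Complex.exp (∫ s in (0 : ℝ)..t, (lam + (θ s + ψ s)))) := by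
  set z : ℝ → ℂ := fun t => θ t + ψ t with hz
  have hzc : ContDiff ℝ (n - 2 : ℕ) z := hθ.add hψ
  have hle : ∀ k < n - 1, (k : WithTop ℕ∞) ≤ (n - 2 : ℕ) := fun k hk => by
    exact_mod_cast (by omega : k ≤ n - 2)
  have hsplit : riccatiRHS n a r lam z =
      fun t => riccatiRHS n a μ lam θ t + psiRHS n a r ν lam θ ψ t := by
    ext t
    refine riccatiRHS_split a lam (fun i hi => hdec i hi t) fun k hk => ?_
    exact iteratedDeriv_fun_add (hθ.of_le (hle k hk)).contDiffAt (hψ.of_le (hle k hk)).contDiffAt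
  have hc : Continuous (riccatiRHS n a r lam z) :=
    fun_rhsAt_mem (continuousSubalgebra (α := ℝ) (R := ℂ) (A := ℂ)) a lam
      (x := fun k => iteratedDeriv k z) hr fun k hk => hzc.continuous_iteratedDeriv k (hle k hk)
  have hR : SolvesRiccati n a r lam z := by
    refine solvesRiccati_of_green hn ha hlam hroot hγ hre hc (fun t j => ?_) fun t => ?_
    · rw [hsplit]
      simp only [mul_add]
      exact ((hθG t).1 j).add ((hψG t).1 j)
    · rw [hsplit, Green_add (hθG t).1 (hψG t).1, neg_add, ← (hθG t).2, ← (hψG t).2]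
  refine ⟨hR, solvesLinear_of_solvesRiccati hn ha hrn hlam hR fun t => ?_⟩
  have hcont : Continuous fun s => lam + z s := continuous_const.add hzc.continuous
  have hd : HasDerivAt (fun t => ∫ s in (0 : ℝ)..t, (lam + z s)) (lam + z t) t :=
    intervalIntegral.integral_hasDerivAt_right (hcont.intervalIntegrable _ _)
      (hcont.stronglyMeasurableAtFilter _ _) hcont.continuousAt
  exact hd.cexp.congr_deriv (mul_comm _ _)

/-- Both cases are the same statement for a filter, `atTop` or `atTop ⊔ atBot`, of which only three
properties are used. -/
theorem class_cases {A V : Set (ℝ → ℂ)} (hAV : (A = AAP ∧ V = BC0) ∨ (A = AAP0 ∧ V = C00)) :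
    ∃ l : Filter ℝ, l.IsCountablyGenerated ∧ atTop ≤ l ∧
      (∀ u : ℝ, Tendsto (fun t => t - u) l l) ∧ A = AsympAP l ∧ V = Vanishing l := by
  have htop : ∀ u : ℝ, Tendsto (fun t : ℝ => t - u) atTop atTop := fun u =>
    tendsto_atTop_add_const_right _ (-u) tendsto_id
  have hbot : ∀ u : ℝ, Tendsto (fun t : ℝ => t - u) atBot atBot := fun u =>
    tendsto_atBot_add_const_right _ (-u) tendsto_id
  rcases hAV with ⟨rfl, rfl⟩ | ⟨rfl, rfl⟩
  · exact ⟨atTop, inferInstance, le_rfl, htop, AAP_eq, BC0_eq⟩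
  · exact ⟨atTop ⊔ atBot, inferInstance, le_sup_left, fun u => (htop u).sup_sup (hbot u),
      AAP0_eq, C00_eq⟩

end Main

end PoincarePerron

end

/-! ### The theorem for both pairs of function classes -/

theorem theorem3p5
    (n : ℕ) (hn : 2 ≤ n)
    -- coefficients, with the conventions `a_n = 1` and `r_n = 0`
    (a : ℕ → ℂ) (ha : a n = 1)
    (r : ℕ → ℝ → ℂ) (hrn : ∀ t, r n t = 0)
    -- the `n` characteristic roots `lam, root 0, …, root (n - 2)` have distinct real parts
    (lam : ℂ) (root : Fin (n - 1) → ℂ)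
    (hlam : (P n a).eval lam = 0)
    (hroot : ∀ j, (P n a).eval (root j) = 0)
    (hre : ∀ j, (root j).re ≠ lam.re)
    (hre' : ∀ j k, j ≠ k → (root j).re ≠ (root k).re)
    (γ : Fin (n - 1) → ℂ) (hγ : ∀ j, γ j = root j - lam)
    -- the two cases of the theorem
    (A V : Set (ℝ → ℂ)) (hAV : (A = AAP ∧ V = BC0) ∨ (A = AAP0 ∧ V = C00))
    (hr : ∀ i < n, r i ∈ A)
    (hsmall : Smallness n a r lam γ) :
    (∃ y z : ℝ → ℂ,
      SolvesLinear n a r y ∧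
      (∀ t, y t = explicitY n γ lam (riccatiRHS n a r lam z) t) ∧
      SolvesRiccati n a r lam z ∧
      z ∈ DerivsIn A (n - 2) ∧
      ∀ μ ν : ℕ → ℝ → ℂ, Decomposes n V r μ ν →
        ∃ θ ψ : ℝ → ℂ,
          (∀ t, z t = θ t + ψ t) ∧
          θ ∈ DerivsIn AP (n - 2) ∧
          ψ ∈ DerivsIn V (n - 2) ∧
          SolvesGreen γ θ (riccatiRHS n a μ lam θ) ∧
          SolvesGreen γ ψ (psiRHS n a r ν lam θ ψ)) ∧
    (∀ μ ν : ℕ → ℝ → ℂ, Decomposes n V r μ ν →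
      ∀ θ ψ : ℝ → ℂ,
        θ ∈ AP → ContDiff ℝ (n - 2 : ℕ) θ →
        ψ ∈ V → ContDiff ℝ (n - 2 : ℕ) ψ →
        SolvesGreen γ θ (riccatiRHS n a μ lam θ) →
        SolvesGreen γ ψ (psiRHS n a r ν lam θ ψ) →
        (fun t => θ t + ψ t) ∈ A ∧
        (θ ∈ DerivsIn AP (n - 2) → ψ ∈ DerivsIn V (n - 2) → (fun t => θ t + ψ t) ∈ DerivsIn A (n - 2)) ∧
        SolvesRiccati n a r lam (fun t => θ t + ψ t) ∧
        SolvesLinear n a r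
          (fun t => Complex.exp (∫ s in (0 : ℝ)..t, (lam + (θ s + ψ s))))) := by
  obtain ⟨l, hlc, hl, hsh, rfl, rfl⟩ := class_cases hAV
  have hγre : ∀ j, (γ j).re ≠ 0 := fun j => by
    rw [hγ, Complex.sub_re]; exact sub_ne_zero.2 (hre j)
  have hγinj : Function.Injective γ := fun j k hjk => by
    by_contra hne
    refine hre' j k hne ?_
    rw [hγ, hγ] at hjk
    rw [sub_left_inj.1 hjk]
  have hγroot : ∀ j, (P n a).eval (lam + γ j) = 0 := fun j => by
    rw [hγ, add_sub_cancel]; exact hroot j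
  refine ⟨exists_solution hn hl hsh ha hrn hlam hγroot hγinj hγre hr hsmall,
    fun μ ν hdec θ ψ hθ hθc hψ hψc hθG hψG => ?_⟩
  have hrc : ∀ i ≤ n, Continuous (r i) := fun i hi =>
    (AsympAP_subset_BC l (mem_AsympAP_of_lt hr hrn i hi)).1
  exact ⟨⟨θ, hθ, ψ, hψ, rfl⟩, DerivsIn_add,
    solves_of_solvesGreen hn ha hrn hlam hγroot hγinj hγre hrc
      (fun i hi => (hdec.mem_le hrn i hi).2.2) hθc hψc hθG hψG⟩
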